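/- Let $K$ be a field of characteristic zero and $I$ a finite non-empty set. Let $\mathcal{H}_I$ be the Connes–Kreimer Hopf algebra of rooted trees decorated by $I$: the polynomial algebra over $K$ generated by the rooted trees with vertices decorated by $I$, with the coproduct given on trees by $\Delta(t)=\sum_c P^c(t)\otimes R^c(t)$, where $c$ runs over the admissible cuts of $t$ (the empty and the total one included). It is graded by the number of vertices, and $B_i^+$ denotes the operator grafting the trees of a forest on a common root decorated by $i$. A system of Dyson–Schwinger equations (SDSE) $(S)$ is given by non-constant formal series $F_i\in K[[h_j,\ j\in I]]$, $i\in I$, normalised by $F_i(0,\ldots,0)=1$; it has a unique solution $X_i=B_i^+(F_i(X_j,\ j\in I))$, $i\in I$, in the completion of $\mathcal{H}_I$. The system is Hopf if the subalgebra of $\mathcal{H}_I$ generated by the homogeneous components of the $X_i$ is a Hopf subalgebra. Its graph $G_{(S)}$ is the oriented graph with vertex set $I$ and an edge from $i$ to $j$ if and only if $\partial F_i/\partial h_j\neq 0$. The system is connected if $G_{(S)}$ is connected (orientations being forgotten), and symmetric if $G_{(S)}$ has no self-loop and, for $i\neq j$, there is an edge from $i$ to $j$ if and only if there is one from $j$ to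 $i$. A change of variables replaces $(F_i)_{i\in I}$ by $(\mu_iF_i(\lambda_jh_j,\ j\in I))_{i\in I}$ for some non-zero scalars $\lambda_i,\mu_i$. A system $(F'_x)_{x\in J}$ is a dilatation of a system $(F_a)_{a\in A}$ if there is a partition $J=\bigsqcup_{a\in A}J_a$ into non-empty parts such that $F'_x=F_a\bigl(\sum_{y\in J_b}h_y,\ b\in A\bigr)$ for all $a\in A$ and $x\in J_a$. **Theorem.** Let $(S)$ be a connected symmetric Hopf SDSE. Then at least one of the following holds: 1. $(S)$ is $2$-multicyclic: up to a change of variables, it is a dilatation of the system $F_1=1+h_2$, $F_2=1+h_1$; 2. $(S)$ is quasi-complete: up to a change of variables, it is, for some $M\geq 2$, a dilatation of the system $F_i=\prod_{j\neq i}(1-h_j)^{-1}$, $1\leq i\leq M$. -/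

import Mathlib

universe u v

namespace DSE

/-! ### Decorated rooted trees

A rooted tree decorated by `D` is a root decoration together with a finite multiset of decorated
rooted trees (the subtrees attached to the root): the type of decorated rooted trees is the initial
algebra of the functor `α ↦ D × Multiset α`. -/

/-- A root decoration and a finite multiset of children. -/
structure TreeShape (D : Type u) (α : Type u) : Type u where
  root : D
  children : Multiset α

instance TreeShape.instFunctor (D : Type u) : Functor (TreeShape D) where
  map f x := ⟨x.root, x.children.map f⟩

/-- `TreeShape D` is a quotient of the polynomial functor of lists with a decoration. -/
noncomputable instance TreeShape.instQPF (D : Type u) : QPF (TreeShape D) where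
  P := ⟨D × ℕ, fun a => ULift.{u} (Fin a.2)⟩
  abs x := ⟨x.1.1, (List.ofFn fun k => x.2 ⟨k⟩ : List _)⟩
  repr x := ⟨(x.root, x.children.toList.length), fun k => x.children.toList.get k.down⟩
  abs_repr := by
    rintro α ⟨d, s⟩
    have h : (List.ofFn fun k : Fin s.toList.length => s.toList.get k) = s.toList := List.ofFn_get _
    have h' : (((List.ofFn fun k : Fin s.toList.length => s.toList.get k) : List α) : Multiset α)
        = s := by rw [h, Multiset.coe_toList]
    exact congrArg (TreeShape.mk d) h'
  abs_map := by
    rintro α β f ⟨⟨d, n⟩, g⟩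
    simp [PFunctor.map, Functor.map, List.map_ofFn, Function.comp_def]

/-- Rooted trees with vertices decorated by `D`. -/
def Tree (D : Type u) : Type u := QPF.Fix (TreeShape D)

namespace Tree

variable {D : Type u}

/-- The tree obtained by grafting the trees of the forest `s` on a common root decorated by `d`. -/
noncomputable def node (d : D) (s : Multiset (Tree D)) : Tree D :=
  QPF.Fix.mk (F := TreeShape D) ⟨d, s⟩

/-- The decoration of the root. -/
noncomputable def root (t : Tree D) : D := (QPF.Fix.dest (F := TreeShape D) t).root

/-- The forest obtained by deleting the root. -/
noncomputable def children (t : Tree D) : Multiset (Tree D) :=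
  (QPF.Fix.dest (F := TreeShape D) t).children

@[simp] theorem root_node (d : D) (s : Multiset (Tree D)) : (node d s).root = d := by
  simp only [root, node, QPF.Fix.dest_mk]

@[simp] theorem children_node (d : D) (s : Multiset (Tree D)) : (node d s).children = s := by
  simp only [children, node, QPF.Fix.dest_mk]

@[simp] theorem node_root_children (t : Tree D) : node t.root t.children = t :=
  QPF.Fix.mk_dest (F := TreeShape D) t

theorem induction {p : Tree D → Prop} (h : ∀ d s, (∀ t ∈ s, p t) → p (node d s)) (t : Tree D) :
    p t := by
  refine QPF.Fix.ind (F := TreeShape D) p ?_ t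
  rintro x hx
  obtain ⟨a, f, rfl, hf⟩ := (QPF.liftp_iff (F := TreeShape D) (α := QPF.Fix (TreeShape D)) p x).1 hx
  refine h _ _ ?_
  intro t ht
  obtain ⟨k, hk⟩ := List.mem_ofFn.1 (Multiset.mem_coe.1 ht)
  exact hk ▸ hf _

theorem wf_children : WellFounded (fun s t : Tree D => s ∈ t.children) := by
  refine ⟨fun t => ?_⟩
  induction t using induction with
  | h d s ih => exact ⟨_, fun t ht => ih t (by simpa using ht)⟩

instance instWellFoundedRelation : WellFoundedRelation (Tree D) := ⟨_, wf_children⟩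

/-- The number of vertices. -/
noncomputable def weight (t : Tree D) : ℕ :=
  1 + (t.children.attach.map fun s => weight s.1).sum
termination_by t
decreasing_by exact s.2

/-- The multiset of all pairs `(P^c(t), R^c(t))`, `c` running over the admissible cuts of `t`: the
total cut contributes `(t, 1)`; any other admissible cut is the choice, for each child `s` of the
root, of an admissible cut of `s`, the total cut of `s` meaning that the edge between the root and
`s` is cut. Forests are written additively, as multisets of trees. -/
noncomputable def admCuts (t : Tree D) : Multiset (Multiset (Tree D) × Multiset (Tree D)) :=
  ({t}, 0) ::ₘ (Multiset.Sections (t.children.attach.map fun s => admCuts s.1)).map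
    fun c => (c.sum.1, {node t.root c.sum.2})
termination_by t
decreasing_by exact s.2

theorem weight_node (d : D) (s : Multiset (Tree D)) :
    (node d s).weight = 1 + (s.map weight).sum := by
  rw [weight, children_node, Multiset.attach_map_val' s weight]

theorem admCuts_node (d : D) (s : Multiset (Tree D)) :
    (node d s).admCuts = ({node d s}, 0) ::ₘ
      (Multiset.Sections (s.map admCuts)).map fun c => (c.sum.1, {node d c.sum.2}) := by
  rw [admCuts, children_node, root_node, Multiset.attach_map_val' s admCuts]

theorem weight_pos (t : Tree D) : 0 < t.weight := by
  rw [weight]; omega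

end Tree

/-! ### The Hopf algebra of decorated rooted trees -/

/-- The number of vertices of a forest, a forest being given by the multiplicities of its trees. -/
noncomputable def forestWeight {D : Type u} : (Tree D →₀ ℕ) →+ ℕ := Finsupp.weight Tree.weight

/-- The algebra `H_D`: the polynomial algebra generated by the decorated rooted trees. -/
abbrev TreeAlgebra (K : Type v) [Field K] (D : Type u) : Type (max u v) := MvPolynomial (Tree D) K

/-- The element of `H_D` given by a forest. -/
noncomputable def forest (K : Type v) [Field K] {D : Type u} (s : Multiset (Tree D)) :
    TreeAlgebra K D :=
  (s.map fun t => (MvPolynomial.X t : MvPolynomial (Tree D) K)).prod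

open scoped TensorProduct in
/-- The coproduct: the algebra morphism with `Δ(t) = ∑ P^c(t) ⊗ R^c(t)`, the sum running over all
admissible cuts of `t`, the empty one and the total one included. -/
noncomputable def coproduct (K : Type v) [Field K] (D : Type u) :
    TreeAlgebra K D →ₐ[K] TreeAlgebra K D ⊗[K] TreeAlgebra K D :=
  MvPolynomial.aeval fun t => (t.admCuts.map fun c => forest K c.1 ⊗ₜ[K] forest K c.2).sum

/-- `A` is a Hopf subalgebra of `H_D`: the subalgebra `A` satisfies `Δ(A) ⊆ A ⊗ A`. (For the
subalgebras considered below, which are generated by homogeneous elements, stability under the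
antipode is automatic, `H_D` being graded and connected.) -/
def IsHopfSubalgebra {K : Type v} [Field K] {D : Type u} (A : Subalgebra K (TreeAlgebra K D)) :
    Prop :=
  ∀ a ∈ A, coproduct K D a ∈ (Algebra.TensorProduct.map A.val A.val).range

/-! ### The completion and the grafting operators

For finite `D` there are finitely many forests of each weight, and the completion
`∏ n, H_D(n)` is the algebra of all formal series in the decorated rooted trees. -/

/-- The completion of `H_D` for its gradation by the number of vertices, for finite `D`. -/
abbrev CompletedTreeAlgebra (K : Type v) [Field K] (D : Type u) : Type (max u v) :=
  MvPowerSeries (Tree D) K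

open Classical in
/-- The grafting operator `B_d^+`, extended to infinite sums of forests: the coefficient of the tree
`B_d^+(e)` in `B_d^+(f)` is the coefficient of the forest `e` in `f`, and the coefficients of all
forests that are not of this form vanish. -/
noncomputable def graft {K : Type v} [Field K] {D : Type u} (d : D)
    (f : CompletedTreeAlgebra K D) : CompletedTreeAlgebra K D :=
  fun m => if h : ∃ e : Tree D →₀ ℕ, m = Finsupp.single (Tree.node d (Finsupp.toMultiset e)) 1
    then MvPowerSeries.coeff h.choose f else 0

section

variable {K : Type v} [Field K] {D : Type u}

theorem node_toMultiset_injective (d : D) :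
    Function.Injective fun e : Tree D →₀ ℕ =>
      (Finsupp.single (Tree.node d (Finsupp.toMultiset e)) 1 : Tree D →₀ ℕ) := by
  intro e e' h
  have h1 := Finsupp.single_left_injective (one_ne_zero) h
  have h2 := congrArg Tree.children h1
  rw [Tree.children_node, Tree.children_node] at h2
  classical
  rw [← Finsupp.toMultiset_toFinsupp e, h2, Finsupp.toMultiset_toFinsupp]

theorem coeff_graft (d : D) (f : CompletedTreeAlgebra K D) (e : Tree D →₀ ℕ) :
    MvPowerSeries.coeff (Finsupp.single (Tree.node d (Finsupp.toMultiset e)) 1) (graft d f) =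
      MvPowerSeries.coeff e f := by
  have h : ∃ e' : Tree D →₀ ℕ, (Finsupp.single (Tree.node d (Finsupp.toMultiset e)) 1 :
      Tree D →₀ ℕ) = Finsupp.single (Tree.node d (Finsupp.toMultiset e')) 1 := ⟨e, rfl⟩
  have h' : h.choose = e := (node_toMultiset_injective d h.choose_spec).symm
  rw [MvPowerSeries.coeff_apply, graft, dif_pos h, h']

theorem coeff_graft_of_ne (d : D) (f : CompletedTreeAlgebra K D) (m : Tree D →₀ ℕ)
    (h : ∀ e : Tree D →₀ ℕ, m ≠ Finsupp.single (Tree.node d (Finsupp.toMultiset e)) 1) :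
    MvPowerSeries.coeff m (graft d f) = 0 := by
  rw [MvPowerSeries.coeff_apply, graft, dif_neg (by push Not; exact h)]

theorem constantCoeff_graft (d : D) (f : CompletedTreeAlgebra K D) :
    MvPowerSeries.constantCoeff (graft d f) = 0 := by
  rw [← MvPowerSeries.coeff_zero_eq_constantCoeff_apply]
  refine coeff_graft_of_ne d f 0 fun e h => ?_
  simpa using DFunLike.congr_fun h (Tree.node d (Finsupp.toMultiset e))

theorem weight_node_toMultiset (d : D) (e : Tree D →₀ ℕ) :
    (Tree.node d (Finsupp.toMultiset e)).weight = 1 + forestWeight e := by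
  rw [Tree.weight_node]
  congr 1
  induction e using Finsupp.induction_linear with
  | zero => simp [forestWeight]
  | add f g hf hg => rw [map_add, Multiset.map_add, Multiset.sum_add, hf, hg, map_add]
  | single t n => simp [forestWeight, Finsupp.weight_single, Multiset.map_nsmul,
      Multiset.sum_nsmul]

theorem weight_le_forestWeight (m : Tree D →₀ ℕ) (t : Tree D) :
    m t * t.weight ≤ forestWeight m := by
  rw [forestWeight, Finsupp.weight_apply, Finsupp.sum]
  by_cases ht : t ∈ m.support
  · exact Finset.single_le_sum (f := fun t => m t * t.weight) (fun _ _ => Nat.zero_le _) ht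
  · simp [Finsupp.notMem_support_iff.1 ht]

theorem finite_forests_of_finite_trees (n : ℕ) (h : {t : Tree D | t.weight ≤ n}.Finite) :
    {m : Tree D →₀ ℕ | forestWeight m ≤ n}.Finite := by
  classical
  refine (Set.finite_Icc 0 (∑ t ∈ h.toFinset, Finsupp.single t n : Tree D →₀ ℕ)).subset ?_
  intro m hm
  refine ⟨zero_le, fun t => ?_⟩
  have hm' : forestWeight m ≤ n := hm
  have h1 := (weight_le_forestWeight m t).trans hm'
  have hw := t.weight_pos
  rw [Finsupp.finsetSum_apply]
  by_cases h0 : m t = 0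
  · simp [h0]
  · have ht : t ∈ h.toFinset := by
      simpa using (Nat.le_mul_of_pos_left _ (Nat.pos_of_ne_zero h0)).trans h1
    refine le_trans ?_ (Finset.single_le_sum (f := fun s => (Finsupp.single s n : Tree D →₀ ℕ) t)
      (fun _ _ => Nat.zero_le _) ht)
    simpa using (Nat.le_mul_of_pos_right _ hw).trans h1

theorem finite_trees_weight_le [Finite D] (n : ℕ) : {t : Tree D | t.weight ≤ n}.Finite := by
  induction n with
  | zero => exact Set.finite_empty.subset fun t ht => absurd t.weight_pos (by simpa using ht)
  | succ n ih =>
    classical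
    refine (Set.finite_univ.image2 (fun (d : D) (e : Tree D →₀ ℕ) =>
      Tree.node d (Finsupp.toMultiset e)) (finite_forests_of_finite_trees n ih)).subset ?_
    intro t ht
    have ht' : t.weight ≤ n + 1 := ht
    have key : Tree.node t.root (Finsupp.toMultiset (Multiset.toFinsupp t.children)) = t := by
      rw [Multiset.toFinsupp_toMultiset, Tree.node_root_children]
    refine ⟨t.root, Set.mem_univ _, Multiset.toFinsupp t.children, ?_, key⟩
    rw [← key, weight_node_toMultiset] at ht'
    change forestWeight _ ≤ n
    omega

theorem finite_forests_weight_le [Finite D] (n : ℕ) :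
    {m : Tree D →₀ ℕ | forestWeight m ≤ n}.Finite :=
  finite_forests_of_finite_trees n (finite_trees_weight_le n)

theorem finite_forests_weight_eq [Finite D] (n : ℕ) :
    {m : Tree D →₀ ℕ | forestWeight m = n}.Finite :=
  (finite_forests_weight_le n).subset fun _ h => le_of_eq h

end

/-- The homogeneous component of degree `n` of an element of the completion. -/
noncomputable def component {K : Type v} [Field K] {D : Type u} [Finite D] (n : ℕ)
    (f : CompletedTreeAlgebra K D) : TreeAlgebra K D :=
  ∑ m ∈ (finite_forests_weight_eq (D := D) n).toFinset,
    MvPolynomial.monomial m (MvPowerSeries.coeff m f)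

theorem coeff_component {K : Type v} [Field K] {D : Type u} [Finite D] (n : ℕ)
    (f : CompletedTreeAlgebra K D) (m : Tree D →₀ ℕ) :
    MvPolynomial.coeff m (component n f) =
      if forestWeight m = n then MvPowerSeries.coeff m f else 0 := by
  classical
  simp [component, MvPolynomial.coeff_sum, MvPolynomial.coeff_monomial, Finset.sum_ite_eq']

/-! ### Systems of Dyson-Schwinger equations

A system with set of vertices `I` is given by a family `F` of formal series `F i` in the
indeterminates `h_j`, `j ∈ I`. -/

section

variable {K : Type v} [Field K] {I : Type u}

/-- `X` is a solution of the system associated to `F`: `X_i = B_i^+(F_i(X_j, j ∈ I))` for all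
`i`. -/
def IsSolution (F : I → MvPowerSeries I K) (X : I → CompletedTreeAlgebra K I) : Prop :=
  ∀ i, X i = graft i (MvPowerSeries.subst X (F i))

/-- The successive approximations of the solution, starting from `0`. -/
noncomputable def approx (F : I → MvPowerSeries I K) : ℕ → I → CompletedTreeAlgebra K I
  | 0 => 0
  | n + 1 => fun i => graft i (MvPowerSeries.subst (approx F n) (F i))

/-- The solution of the system associated to `F`: its homogeneous component of degree `n` is that of
the `n`-th approximation (see `isSolution_iff`). -/
noncomputable def solution (F : I → MvPowerSeries I K) (i : I) : CompletedTreeAlgebra K I :=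
  fun m => MvPowerSeries.coeff m (approx F (forestWeight m) i)

/-- Equality of the homogeneous components of degree at most `n`. -/
def Agree (n : ℕ) (f g : CompletedTreeAlgebra K I) : Prop :=
  ∀ m, forestWeight m ≤ n → MvPowerSeries.coeff m f = MvPowerSeries.coeff m g

theorem Agree.mul {n : ℕ} {f g f' g' : CompletedTreeAlgebra K I} (h : Agree n f g)
    (h' : Agree n f' g') : Agree n (f * f') (g * g') := by
  classical
  intro m hm
  rw [MvPowerSeries.coeff_mul, MvPowerSeries.coeff_mul]
  refine Finset.sum_congr rfl fun p hp => ?_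
  have hs : forestWeight p.1 + forestWeight p.2 = forestWeight m := by
    rw [← map_add, Finset.HasAntidiagonal.mem_antidiagonal.1 hp]
  rw [h p.1 (by omega), h' p.2 (by omega)]

theorem Agree.pow {n : ℕ} {f g : CompletedTreeAlgebra K I} (h : Agree n f g) (k : ℕ) :
    Agree n (f ^ k) (g ^ k) := by
  induction k with
  | zero => simp only [pow_zero]; exact fun _ _ => rfl
  | succ k ih => simp only [pow_succ]; exact ih.mul h

theorem Agree.subst [Finite I] {n : ℕ} {X Y : I → CompletedTreeAlgebra K I}
    (hX : ∀ i, MvPowerSeries.constantCoeff (X i) = 0)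
    (hY : ∀ i, MvPowerSeries.constantCoeff (Y i) = 0) (h : ∀ i, Agree n (X i) (Y i))
    (f : MvPowerSeries I K) :
    Agree n (MvPowerSeries.subst X f) (MvPowerSeries.subst Y f) := by
  classical
  intro m hm
  rw [MvPowerSeries.coeff_subst (MvPowerSeries.hasSubst_of_constantCoeff_zero hX),
    MvPowerSeries.coeff_subst (MvPowerSeries.hasSubst_of_constantCoeff_zero hY)]
  refine finsum_congr fun d => ?_
  congr 1
  refine Finset.induction_on (motive := fun s => Agree n (∏ i ∈ s, X i ^ d i) (∏ i ∈ s, Y i ^ d i))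
    d.support ?_ ?_ m hm
  · intro _ _; rfl
  · intro i s hi ih
    rw [Finset.prod_insert hi, Finset.prod_insert hi]
    exact ((h i).pow _).mul ih

theorem Agree.graft {n : ℕ} {f g : CompletedTreeAlgebra K I} (h : Agree n f g) (i : I) :
    Agree (n + 1) (graft i f) (graft i g) := by
  intro m hm
  by_cases hm' : ∃ e : Tree I →₀ ℕ, m = Finsupp.single (Tree.node i (Finsupp.toMultiset e)) 1
  · obtain ⟨e, rfl⟩ := hm'
    rw [coeff_graft, coeff_graft]
    refine h e ?_
    rw [forestWeight, Finsupp.weight_single, weight_node_toMultiset, smul_eq_mul, one_mul] at hm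
    omega
  · push Not at hm'
    rw [coeff_graft_of_ne _ _ _ hm', coeff_graft_of_ne _ _ _ hm']

theorem agree_zero {f g : CompletedTreeAlgebra K I}
    (hf : MvPowerSeries.constantCoeff f = 0) (hg : MvPowerSeries.constantCoeff g = 0) :
    Agree 0 f g := by
  intro m hm
  have hm0 : m = 0 := by
    ext t
    have h1 := weight_le_forestWeight m t
    have h2 := t.weight_pos
    rw [Nat.le_zero.1 hm, Nat.le_zero, Nat.mul_eq_zero] at h1
    rcases h1 with h1 | h1
    · simpa using h1
    · omega
  rw [hm0, MvPowerSeries.coeff_zero_eq_constantCoeff_apply,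
    MvPowerSeries.coeff_zero_eq_constantCoeff_apply, hf, hg]

theorem constantCoeff_approx (F : I → MvPowerSeries I K) (n : ℕ) (i : I) :
    MvPowerSeries.constantCoeff (approx F n i) = 0 := by
  cases n with
  | zero => simp [approx]
  | succ n => exact constantCoeff_graft _ _

theorem agree_approx_of_isSolution [Finite I] {F : I → MvPowerSeries I K}
    {X : I → CompletedTreeAlgebra K I} (hX : IsSolution F X) (n : ℕ) (i : I) :
    Agree n (X i) (approx F n i) := by
  have h0 : ∀ i, MvPowerSeries.constantCoeff (X i) = 0 := fun i => by
    rw [hX i]; exact constantCoeff_graft _ _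
  induction n generalizing i with
  | zero => exact agree_zero (h0 i) (constantCoeff_approx F 0 i)
  | succ n ih =>
    rw [hX i]
    exact (Agree.subst h0 (constantCoeff_approx F n) ih (F i)).graft i

theorem agree_approx_succ [Finite I] (F : I → MvPowerSeries I K) (n : ℕ) (i : I) :
    Agree n (approx F n i) (approx F (n + 1) i) := by
  induction n generalizing i with
  | zero => exact agree_zero (constantCoeff_approx F 0 i) (constantCoeff_approx F 1 i)
  | succ n ih =>
    exact (Agree.subst (constantCoeff_approx F n) (constantCoeff_approx F (n + 1)) ih (F i)).graft i

theorem agree_solution_approx [Finite I] (F : I → MvPowerSeries I K) (n : ℕ) (i : I) :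
    Agree n (solution F i) (approx F n i) := by
  intro m hm
  rw [MvPowerSeries.coeff_apply, solution]
  induction n, hm using Nat.le_induction with
  | base => rfl
  | succ n hn ih => rw [ih, agree_approx_succ F n i m hn]

/-- Every system has one and only one solution. -/
theorem isSolution_iff [Finite I] (F : I → MvPowerSeries I K) (X : I → CompletedTreeAlgebra K I) :
    IsSolution F X ↔ X = solution F := by
  constructor
  · intro hX
    funext i
    ext m
    exact agree_approx_of_isSolution hX _ i m le_rfl
  · rintro rfl i
    have h0 : ∀ i, MvPowerSeries.constantCoeff (solution F i) = 0 := fun i => by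
      rw [← MvPowerSeries.coeff_zero_eq_constantCoeff_apply,
        agree_solution_approx F 0 i 0 (by simp)]
      simp [constantCoeff_approx]
    ext m
    rw [agree_solution_approx F (forestWeight m + 1) i m (by omega)]
    exact ((Agree.subst h0 (constantCoeff_approx F (forestWeight m))
      (agree_solution_approx F (forestWeight m)) (F i)).graft i m (by omega)).symm

/-- The subalgebra `H_(S)` of `H_I` generated by the homogeneous components of the solution. -/
noncomputable def generatedSubalgebra [Finite I] (F : I → MvPowerSeries I K) :
    Subalgebra K (TreeAlgebra K I) :=
  Algebra.adjoin K (Set.range fun p : I × ℕ => component p.2 (solution F p.1))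

/-- The system associated to `F` is Hopf. -/
def IsHopf [Finite I] (F : I → MvPowerSeries I K) : Prop :=
  IsHopfSubalgebra (generatedSubalgebra F)

/-- The oriented graph of the system: there is an edge from `i` to `j` if and only if
`∂F_i/∂h_j ≠ 0`. -/
def graph (F : I → MvPowerSeries I K) : Digraph I where
  Adj i j := MvPowerSeries.pderiv K j (F i) ≠ 0

/-- The system is connected: its graph is connected, orientations being forgotten. -/
def IsConnected (F : I → MvPowerSeries I K) : Prop :=
  (graph F).toSimpleGraphInclusive.Connected

/-- The system is symmetric: no vertex of its graph is self-dependent, and for `i ≠ j`, there is an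
edge from `i` to `j` if and only if there is an edge from `j` to `i`. -/
def IsSymmetric (F : I → MvPowerSeries I K) : Prop :=
  (∀ i, ¬ (graph F).Adj i i) ∧ ∀ i j, i ≠ j → ((graph F).Adj i j ↔ (graph F).Adj j i)

/-- `F'` is obtained from `F` by a change of variables: `F'_i = μ_i F_i(λ_j h_j, j ∈ I)` for some
nonzero scalars `λ_i`, `μ_i`. -/
def IsChangeOfVariables (F F' : I → MvPowerSeries I K) : Prop :=
  ∃ l μ : I → K, (∀ i, l i ≠ 0) ∧ (∀ i, μ i ≠ 0) ∧
    ∀ i, F' i = μ i • MvPowerSeries.rescale l (F i)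

end

open Classical in
/-- The system `F'`, with set of vertices `J`, is a dilatation of the system `F`, with set of
vertices `I`: there is a partition of `J` into nonempty parts `J_i`, `i ∈ I` (the fibres of a
surjection `p`), such that `F'_x = F_i(∑_{y ∈ J_j} h_y, j ∈ I)` for all `x ∈ J_i`. -/
def IsDilatation {K : Type v} [Field K] {I J : Type*} [Fintype J]
    (F : I → MvPowerSeries I K) (F' : J → MvPowerSeries J K) : Prop :=
  ∃ p : J → I, Function.Surjective p ∧ ∀ x, F' x =
    MvPowerSeries.subst (fun j => ∑ y with p y = j, (MvPowerSeries.X y : MvPowerSeries J K))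
      (F (p x))

/-- The oriented cycle of length `N`: `F_i = 1 + h_{i+1}`, `i ∈ ℤ/Nℤ`. -/
noncomputable def cycleSystem (K : Type v) [Field K] (N : ℕ) (i : ZMod N) :
    MvPowerSeries (ZMod N) K :=
  1 + MvPowerSeries.X (i + 1)

/-- The system `F_i = ∏_{j ≠ i} (1 - h_j)⁻¹`, `1 ≤ i ≤ M`. -/
noncomputable def completeSystem (K : Type v) [Field K] (M : ℕ) (i : Fin M) :
    MvPowerSeries (Fin M) K :=
  ∏ j ∈ Finset.univ.erase i, (1 - MvPowerSeries.X j)⁻¹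

/-- `F` is `N`-multicyclic: up to a change of variables, it is a dilatation of the cycle of length
`N ≥ 2`. -/
def IsMulticyclic {K : Type v} [Field K] {I : Type u} [Fintype I] (N : ℕ)
    (F : I → MvPowerSeries I K) : Prop :=
  2 ≤ N ∧ ∃ F', IsChangeOfVariables F F' ∧ IsDilatation (cycleSystem K N) F'

/-- `F` is quasi-complete: up to a change of variables, it is a dilatation of one of the systems
`completeSystem K M`, `M ≥ 2`. -/
def IsQuasiComplete {K : Type v} [Field K] {I : Type u} [Fintype I]
    (F : I → MvPowerSeries I K) : Prop :=
  ∃ M, 2 ≤ M ∧ ∃ F', IsChangeOfVariables F F' ∧ IsDilatation (completeSystem K M) F'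

end DSE

namespace DSE

/-! ### Cutting a leaf -/

section LeafCut

variable {K : Type v} [Field K] {D : Type u}

open scoped TensorProduct

/-! Pairing the left factor of the coproduct with the linear form "coefficient of the one-vertex
tree `j`" gives an operator that removes a leaf decorated by `j`. That form is an infinitesimal
character, so the operator is a derivation (`leafCut`), and it preserves every Hopf subalgebra
(`leafCut_mem`). In the subalgebra of a Hopf system, the only single trees with root `i` and `n`
vertices come, up to a scalar, from the degree `n` component of `X_i`. Hence leaf cutting acts on
these trees through scalars `l n i j` (`exists_leafCut_eq`).

Now choose, for each `k`, one tree with root `k` occurring in `X_k`, discard all the other trees,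
and rescale so that `X_k` becomes `h_k`. The derivation then sends `h_k` to `δ_kj` plus a multiple
of `h_k`, and the chain rule applied to `F_i` gives a recurrence for its coefficients
(`coeff_relation`). The chosen trees may have any common weight `m ≥ 1`, so the same coefficients
satisfy infinitely many recurrences. Their compatibility is very restrictive.

Symmetry makes the coefficient of `h_j` the same in all `F_k` with `k` adjacent to `j`, so a
rescaling turns all nonzero linear coefficients into 1. Connectedness then forces nonadjacency to be
transitive (`adj_of_not_adj`): the graph is complete multipartite. Comparing the recurrences for `m
= 1` and `m = 2` gives `l 3 j j ∈ {0, 2}`, and this value spreads along edges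
(`multiplier_diag_three_dichotomy`).

If it is 0, triangles and all terms of degree at least 2 are excluded: the graph is complete
bipartite and each `F_i` is 1 plus the sum of its neighbours' variables, a dilated 2-cycle. If it is
2, all multipliers needed are explicit, and the recurrence becomes a first-order differential system
whose solution is the product of the inverses of `1 - ∑ h_y`, over the classes other than that of
`i`: a dilated complete system. -/

theorem forest_toMultiset (e : Tree D →₀ ℕ) :
    forest K (Finsupp.toMultiset e) = MvPolynomial.monomial e 1 := by
  rw [forest, Finsupp.toMultiset_map, Finsupp.prod_toMultiset, MvPolynomial.monomial_eq]
  classical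
  rw [Finsupp.prod_mapDomain_index (by simp) (by intros; rw [pow_add])]
  simp

theorem forest_eq_monomial (s : Multiset (Tree D)) [DecidableEq (Tree D)] :
    forest K s = MvPolynomial.monomial (Multiset.toFinsupp s) 1 := by
  rw [← forest_toMultiset, Multiset.toFinsupp_toMultiset]

@[simp] theorem forest_zero : forest K (0 : Multiset (Tree D)) = 1 := by simp [forest]

theorem forest_add (s t : Multiset (Tree D)) : forest K (s + t) = forest K s * forest K t := by
  simp [forest]

@[simp] theorem forest_singleton (t : Tree D) : forest K {t} = MvPolynomial.X t := by
  simp [forest]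

/-- The grafting operator on polynomials. -/
noncomputable def graftPoly (K : Type v) [Field K] (d : D) :
    TreeAlgebra K D →ₗ[K] TreeAlgebra K D :=
  (MvPolynomial.basisMonomials (Tree D) K).constr K
    fun e => MvPolynomial.X (Tree.node d (Finsupp.toMultiset e))

theorem graftPoly_monomial (d : D) (e : Tree D →₀ ℕ) (c : K) :
    graftPoly K d (MvPolynomial.monomial e c) =
      MvPolynomial.monomial (Finsupp.single (Tree.node d (Finsupp.toMultiset e)) 1) c := by
  have h := (MvPolynomial.basisMonomials (Tree D) K).constr_basis K
    (fun e => (MvPolynomial.X (Tree.node d (Finsupp.toMultiset e)) : TreeAlgebra K D)) e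
  rw [MvPolynomial.coe_basisMonomials] at h
  rw [← mul_one c, ← smul_eq_mul, ← MvPolynomial.smul_monomial, map_smul]
  exact (congrArg (c • ·) h).trans (by simp [MvPolynomial.X, MvPolynomial.smul_monomial])

theorem graftPoly_forest (d : D) (s : Multiset (Tree D)) :
    graftPoly K d (forest K s) = MvPolynomial.X (Tree.node d s) := by
  classical
  rw [forest_eq_monomial, graftPoly_monomial, Multiset.toFinsupp_toMultiset, MvPolynomial.X]

theorem coeff_graftPoly (d : D) (f : TreeAlgebra K D) (e : Tree D →₀ ℕ) :
    MvPolynomial.coeff (Finsupp.single (Tree.node d (Finsupp.toMultiset e)) 1) (graftPoly K d f) =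
      MvPolynomial.coeff e f := by
  classical
  induction f using MvPolynomial.induction_on' with
  | monomial m c =>
    rw [graftPoly_monomial, MvPolynomial.coeff_monomial, MvPolynomial.coeff_monomial]
    simp only [(node_toMultiset_injective d).eq_iff' rfl]
  | add p q hp hq => rw [map_add, MvPolynomial.coeff_add, MvPolynomial.coeff_add, hp, hq]

theorem coeff_graftPoly_of_ne (d : D) (f : TreeAlgebra K D) (m : Tree D →₀ ℕ)
    (h : ∀ e : Tree D →₀ ℕ, m ≠ Finsupp.single (Tree.node d (Finsupp.toMultiset e)) 1) :
    MvPolynomial.coeff m (graftPoly K d f) = 0 := by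
  classical
  induction f using MvPolynomial.induction_on' with
  | monomial e c =>
    rw [graftPoly_monomial, MvPolynomial.coeff_monomial, if_neg (h e).symm]
  | add p q hp hq => rw [map_add, MvPolynomial.coeff_add, hp, hq, add_zero]

/-! ### The coproduct and grafting: the cocycle identity. -/

theorem sections_map_map {α β : Type*} (g : α → β) (S : Multiset (Multiset α)) :
    Multiset.Sections (S.map (Multiset.map g)) = (Multiset.Sections S).map (Multiset.map g) := by
  induction S using Multiset.induction_on with
  | empty => simp
  | cons m S ih =>
    simp [Multiset.sections_cons, ih, Multiset.bind_map, Multiset.map_bind, Multiset.map_map]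

/-- Expanding the product of the sums over cuts amounts to choosing one cut in each tree, which is
what `Multiset.Sections` enumerates. -/
theorem coproduct_forest (s : Multiset (Tree D)) :
    coproduct K D (forest K s) = ((Multiset.Sections (s.map Tree.admCuts)).map
      fun c => forest K c.sum.1 ⊗ₜ[K] forest K c.sum.2).sum := by
  have key : ∀ c : Multiset (Multiset (Tree D) × Multiset (Tree D)),
      forest K c.sum.1 ⊗ₜ[K] forest K c.sum.2 =
        (c.map fun x => forest K x.1 ⊗ₜ[K] forest K x.2).prod := by
    intro c
    induction c using Multiset.induction_on with
    | empty => simp [Algebra.TensorProduct.one_def]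
    | cons x c ih =>
      rw [Multiset.sum_cons, Multiset.map_cons, Multiset.prod_cons, ← ih,
        Algebra.TensorProduct.tmul_mul_tmul, Prod.fst_add, Prod.snd_add, forest_add, forest_add]
  simp only [key]
  have h : (Multiset.Sections (s.map Tree.admCuts)).map
      (fun c => (c.map fun x => forest K x.1 ⊗ₜ[K] forest K x.2).prod) =
      (Multiset.Sections ((s.map Tree.admCuts).map
        (Multiset.map fun x => forest K x.1 ⊗ₜ[K] forest K x.2))).map Multiset.prod := by
    rw [sections_map_map, Multiset.map_map]
    rfl
  rw [h, ← Multiset.prod_map_sum, forest, map_multiset_prod, Multiset.map_map, Multiset.map_map,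
    Multiset.map_map]
  congr 1
  refine Multiset.map_congr rfl fun t _ => ?_
  simp [coproduct]

/-- The Hochschild 1-cocycle property of grafting, `Δ B = B ⊗ 1 + (id ⊗ B) Δ`. It allows every later
computation with cuts to proceed by recursion on the root. -/
theorem coproduct_X_node (d : D) (s : Multiset (Tree D)) :
    coproduct K D (MvPolynomial.X (Tree.node d s)) =
      MvPolynomial.X (Tree.node d s) ⊗ₜ[K] 1 +
        (graftPoly K d).lTensor _ (coproduct K D (forest K s)) := by
  rw [coproduct_forest, coproduct, MvPolynomial.aeval_X, Tree.admCuts_node, Multiset.map_cons,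
    Multiset.sum_cons, forest_singleton, forest_zero, map_multiset_sum, Multiset.map_map,
    Multiset.map_map]
  congr 2
  refine Multiset.map_congr rfl fun c _ => ?_
  simp [graftPoly_forest]

/-! ### Counit and leaf cutting as a derivation. -/

/-- The counit applied to the left factor of the coproduct. -/
noncomputable def counitCoproduct (K : Type v) [Field K] (D : Type u) :
    TreeAlgebra K D →ₐ[K] TreeAlgebra K D :=
  (Algebra.TensorProduct.lid K _).toAlgHom.comp
    ((Algebra.TensorProduct.map (MvPolynomial.aeval fun _ => (0 : K)) (AlgHom.id K _)).comp
      (coproduct K D))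

/-- The cocycle identity and induction on trees: the counit kills the term `B ⊗ 1` and commutes with
grafting on the right factor. This is what turns the Leibniz rule of `leafCut` into an honest one.
-/
theorem counitCoproduct_eq_id : counitCoproduct K D = AlgHom.id K _ := by
  have lT : ∀ (d : D) (u : TreeAlgebra K D ⊗[K] TreeAlgebra K D),
      (Algebra.TensorProduct.lid K _).toAlgHom ((Algebra.TensorProduct.map
        (MvPolynomial.aeval fun _ => (0 : K)) (AlgHom.id K _)) ((graftPoly K d).lTensor _ u)) =
      graftPoly K d ((Algebra.TensorProduct.lid K _).toAlgHom ((Algebra.TensorProduct.map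
        (MvPolynomial.aeval fun _ => (0 : K)) (AlgHom.id K _)) u)) := by
    intro d u
    induction u using TensorProduct.induction_on with
    | zero => simp
    | tmul a b => simp
    | add x y hx hy => simp only [map_add, hx, hy]
  refine MvPolynomial.algHom_ext fun t => ?_
  induction t using Tree.induction with
  | h d s ih =>
    have hs : counitCoproduct K D (forest K s) = forest K s := by
      rw [forest, map_multiset_prod, Multiset.map_map]
      congr 1
      exact Multiset.map_congr rfl fun t ht => ih t ht
    have h := lT d (coproduct K D (forest K s))
    change _ = graftPoly K d (counitCoproduct K D (forest K s)) at h
    rw [AlgHom.id_apply, counitCoproduct]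
    simp only [AlgHom.comp_apply]
    rw [coproduct_X_node, map_add, map_add, h, hs, graftPoly_forest]
    simp

/-- The linear form taking the coefficient of the one-vertex tree decorated by `j`. -/
noncomputable def leafCoeff (K : Type v) [Field K] (j : D) : TreeAlgebra K D →ₗ[K] K :=
  MvPolynomial.lcoeff K (Finsupp.single (Tree.node j 0) 1)

theorem coeff_single_mul {σ : Type*} (t : σ) (a b : MvPolynomial σ K) :
    MvPolynomial.coeff (Finsupp.single t 1) (a * b) =
      MvPolynomial.coeff (Finsupp.single t 1) a * MvPolynomial.coeff 0 b +
        MvPolynomial.coeff 0 a * MvPolynomial.coeff (Finsupp.single t 1) b := by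
  classical
  rw [MvPolynomial.coeff_mul, Finsupp.antidiagonal_single, Finset.sum_map]
  simp [Finset.Nat.antidiagonal_succ, add_comm]

/-- Cutting a leaf decorated by `j`. -/
noncomputable def leafCutLinear (K : Type v) [Field K] (j : D) :
    TreeAlgebra K D →ₗ[K] TreeAlgebra K D :=
  (TensorProduct.lid K _).toLinearMap ∘ₗ (leafCoeff K j).rTensor _ ∘ₗ (coproduct K D).toLinearMap

/-- Cutting a leaf decorated by `j`, as a derivation. -/
noncomputable def leafCut (K : Type v) [Field K] (j : D) :
    Derivation K (TreeAlgebra K D) (TreeAlgebra K D) :=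
  Derivation.mk' (leafCutLinear K j) fun a b => by
    -- The linear coefficient of a product is a derivation over the constant term, so on the tensor
    -- product each factor in turn is hit by `leafCoeff` and the other by the counit.
    have key : ∀ x y : TreeAlgebra K D ⊗[K] TreeAlgebra K D,
        TensorProduct.lid K _ ((leafCoeff K j).rTensor _ (x * y)) =
          (Algebra.TensorProduct.lid K _).toAlgHom ((Algebra.TensorProduct.map
            (MvPolynomial.aeval fun _ => (0 : K)) (AlgHom.id K _)) x) *
            TensorProduct.lid K _ ((leafCoeff K j).rTensor _ y) +
          (Algebra.TensorProduct.lid K _).toAlgHom ((Algebra.TensorProduct.map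
            (MvPolynomial.aeval fun _ => (0 : K)) (AlgHom.id K _)) y) *
            TensorProduct.lid K _ ((leafCoeff K j).rTensor _ x) := by
      intro x y
      induction x using TensorProduct.induction_on with
      | zero => simp
      | add x x' hx hx' => simp only [add_mul, mul_add, map_add, hx, hx']; ring
      | tmul a b =>
        induction y using TensorProduct.induction_on with
        | zero => simp
        | add y y' hy hy' => simp only [add_mul, mul_add, map_add, hy, hy']; ring
        | tmul a' b' =>
          have ha : ∀ p : TreeAlgebra K D,
              MvPolynomial.aeval (fun _ => (0 : K)) p = MvPolynomial.coeff 0 p := fun p => by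
            rw [← MvPolynomial.constantCoeff_eq]
            exact MvPolynomial.aeval_zero p
          simp [leafCoeff, coeff_single_mul, ha, MvPolynomial.smul_eq_C_mul]
          ring
    have hid : ∀ a, (Algebra.TensorProduct.lid K _).toAlgHom ((Algebra.TensorProduct.map
        (MvPolynomial.aeval fun _ => (0 : K)) (AlgHom.id K _)) (coproduct K D a)) = a :=
      fun a => congrArg (fun g => g a) (counitCoproduct_eq_id (K := K) (D := D))
    have h := key (coproduct K D a) (coproduct K D b)
    rw [hid, hid, ← map_mul] at h
    exact h

theorem leafCut_apply (j : D) (f : TreeAlgebra K D) :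
    leafCut K j f = TensorProduct.lid K _ ((leafCoeff K j).rTensor _ (coproduct K D f)) := rfl

/-- By the cocycle identity, a leaf of a grafted tree is cut inside the forest above the root,
except when the root itself is the leaf; this exception is the constant term. -/
theorem leafCut_graftPoly [DecidableEq D] (j d : D) (f : TreeAlgebra K D) :
    leafCut K j (graftPoly K d f) = graftPoly K d (leafCut K j f) +
      if d = j then MvPolynomial.C (MvPolynomial.coeff 0 f) else 0 := by
  classical
  have lT : ∀ u : TreeAlgebra K D ⊗[K] TreeAlgebra K D,
      TensorProduct.lid K _ ((leafCoeff K j).rTensor _ ((graftPoly K d).lTensor _ u)) =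
        graftPoly K d (TensorProduct.lid K _ ((leafCoeff K j).rTensor _ u)) := by
    intro u
    induction u using TensorProduct.induction_on with
    | zero => simp
    | tmul a b => simp
    | add x y hx hy => simp only [map_add, hx, hy]
  induction f using MvPolynomial.induction_on' with
  | add p q hp hq =>
    simp only [map_add, hp, hq, MvPolynomial.coeff_add]
    split_ifs <;> ring
  | monomial e c =>
    have h1 : leafCut K j (graftPoly K d (MvPolynomial.monomial e 1)) =
        graftPoly K d (leafCut K j (MvPolynomial.monomial e 1)) +
          if d = j then MvPolynomial.C (MvPolynomial.coeff 0 (MvPolynomial.monomial e 1)) else 0 := by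
      rw [← forest_toMultiset, graftPoly_forest, leafCut_apply, coproduct_X_node, map_add, map_add,
        lT, leafCut_apply, add_comm]
      congr 1
      rw [LinearMap.rTensor_tmul, TensorProduct.lid_tmul, leafCoeff, MvPolynomial.lcoeff_apply,
        MvPolynomial.coeff_X, forest_toMultiset, MvPolynomial.coeff_monomial]
      have : (Finsupp.single (Tree.node d (Finsupp.toMultiset e)) 1 : Tree D →₀ ℕ) =
          Finsupp.single (Tree.node j 0) 1 ↔ d = j ∧ e = 0 := by
        rw [(Finsupp.single_left_injective (one_ne_zero)).eq_iff]
        constructor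
        · intro h
          have h1 := congrArg Tree.root h
          have h2 := congrArg Tree.children h
          simp only [Tree.root_node, Tree.children_node] at h1 h2
          exact ⟨h1, by rw [← Finsupp.toMultiset_toFinsupp e, h2, map_zero]⟩
        · rintro ⟨rfl, rfl⟩; simp
      simp only [this]
      by_cases h : d = j <;> by_cases h' : e = 0 <;> simp [h, h']
    have hc : MvPolynomial.monomial e c = c • (MvPolynomial.monomial e (1 : K)) := by
      rw [MvPolynomial.smul_monomial, smul_eq_mul, mul_one]
    rw [hc, map_smul, Derivation.map_smul, Derivation.map_smul, map_smul, h1, smul_add]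
    congr 1
    by_cases h : d = j <;> by_cases h' : e = 0 <;> simp [h, h', MvPolynomial.smul_eq_C_mul]

/-- Once `Δ(a)` lies in `A ⊗ A`, applying a linear form to the left factor leaves a combination of
elements of `A`. -/
theorem leafCut_mem {A : Subalgebra K (TreeAlgebra K D)} (hA : IsHopfSubalgebra A) (j : D)
    {a : TreeAlgebra K D} (ha : a ∈ A) : leafCut K j a ∈ A := by
  obtain ⟨u, hu⟩ := hA a ha
  rw [leafCut_apply, ← hu]
  clear hu
  induction u using TensorProduct.induction_on with
  | zero => simp
  | tmul x y => simpa using A.smul_mem y.2 _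
  | add x y hx hy =>
    have := A.add_mem hx hy
    simpa only [map_add] using this

/-- Cutting a leaf lowers the number of vertices by one. -/
theorem weight_of_coeff_leafCut_forest (j : D) (s : Multiset (Tree D))
    (hs : ∀ t ∈ s, ∀ e, MvPolynomial.coeff e (leafCut K j (MvPolynomial.X t)) ≠ 0 →
      forestWeight e + 1 = t.weight) (e : Tree D →₀ ℕ)
    (he : MvPolynomial.coeff e (leafCut K j (forest K s)) ≠ 0) :
    forestWeight e + 1 = (s.map Tree.weight).sum := by
  classical
  induction s using Multiset.induction_on generalizing e with
  | empty => simp at he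
  | cons t s ih =>
    have hs' := fun t' ht' => hs t' (Multiset.mem_cons_of_mem ht')
    rw [Multiset.map_cons, Multiset.sum_cons]
    have hf : forest K (t ::ₘ s) = MvPolynomial.X t * forest K s := by simp [forest]
    rw [hf, Derivation.leibniz, MvPolynomial.coeff_add, smul_eq_mul, smul_eq_mul] at he
    have hw : forestWeight (Multiset.toFinsupp s) = (s.map Tree.weight).sum := by
      have := (weight_node_toMultiset (j) (Multiset.toFinsupp s)).symm
      rw [Multiset.toFinsupp_toMultiset, Tree.weight_node] at this
      omega
    by_cases h1 : MvPolynomial.coeff e (MvPolynomial.X t * leafCut K j (forest K s)) = 0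
    · rw [h1, zero_add, MvPolynomial.coeff_mul] at he
      obtain ⟨p, hp, hne⟩ := Finset.exists_ne_zero_of_sum_ne_zero he
      rw [forest_eq_monomial, MvPolynomial.coeff_monomial] at hne
      have hp1 : Multiset.toFinsupp s = p.1 := by
        by_contra h; exact hne (by rw [if_neg h, zero_mul])
      have hp2 := hs t (Multiset.mem_cons_self _ _) p.2 (right_ne_zero_of_mul hne)
      rw [← Finset.HasAntidiagonal.mem_antidiagonal.1 hp, map_add, ← hp1, hw]
      omega
    · rw [MvPolynomial.coeff_mul] at h1
      obtain ⟨p, hp, hne⟩ := Finset.exists_ne_zero_of_sum_ne_zero h1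
      rw [MvPolynomial.coeff_X] at hne
      have hp1 : Finsupp.single t 1 = p.1 := by
        by_contra h; exact hne (by rw [if_neg h, zero_mul])
      have hp2 := ih hs' p.2 (right_ne_zero_of_mul hne)
      rw [← Finset.HasAntidiagonal.mem_antidiagonal.1 hp, map_add, ← hp1, forestWeight,
        Finsupp.weight_single]
      rw [forestWeight] at hp2
      simp only [one_smul]
      omega

theorem weight_of_coeff_leafCut_X (j : D) (t : Tree D) (e : Tree D →₀ ℕ)
    (he : MvPolynomial.coeff e (leafCut K j (MvPolynomial.X t)) ≠ 0) :
    forestWeight e + 1 = t.weight := by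
  classical
  induction t using Tree.induction generalizing e with
  | h d s ih =>
    rw [← graftPoly_forest, leafCut_graftPoly, MvPolynomial.coeff_add] at he
    rw [Tree.weight_node]
    by_cases h0 : ∃ m : Tree D →₀ ℕ, e = Finsupp.single (Tree.node d (Finsupp.toMultiset m)) 1
    · obtain ⟨m, rfl⟩ := h0
      have hz : MvPolynomial.coeff (Finsupp.single (Tree.node d (Finsupp.toMultiset m)) 1)
          (if d = j then MvPolynomial.C (MvPolynomial.coeff 0 (forest K s)) else 0 :
            TreeAlgebra K D) = 0 := by
        split_ifs
        · rw [MvPolynomial.coeff_C, if_neg]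
          intro h
          simpa using DFunLike.congr_fun h (Tree.node d (Finsupp.toMultiset m))
        · simp
      rw [hz, add_zero, coeff_graftPoly] at he
      have := weight_of_coeff_leafCut_forest j s ih m he
      rw [forestWeight, Finsupp.weight_single, weight_node_toMultiset]
      simp only [one_smul]
      omega
    · push Not at h0
      rw [coeff_graftPoly_of_ne _ _ _ h0, zero_add] at he
      split_ifs at he with hd
      · rw [MvPolynomial.coeff_C] at he
        have he0 : 0 = e := by by_contra h; exact he (if_neg h)
        rw [if_pos he0, forest_eq_monomial, MvPolynomial.coeff_monomial] at he
        have hs0 : Multiset.toFinsupp s = 0 := by by_contra h; exact he (if_neg h)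
        have : s = 0 := by simpa using hs0
        rw [← he0, this]; simp
      · simp at he

theorem forestWeight_single (t : Tree D) : forestWeight (Finsupp.single t 1) = t.weight := by
  rw [forestWeight, Finsupp.weight_single, one_smul]

theorem coeff_leafCut_eq_zero (j : D) (f : TreeAlgebra K D) (e : Tree D →₀ ℕ)
    (hf : ∀ m, forestWeight m = forestWeight e + 1 → MvPolynomial.coeff m f = 0) :
    MvPolynomial.coeff e (leafCut K j f) = 0 := by
  rw [f.as_sum, map_sum, MvPolynomial.coeff_sum]
  refine Finset.sum_eq_zero fun m hm => ?_
  have hc : MvPolynomial.monomial m (MvPolynomial.coeff m f) =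
      (MvPolynomial.coeff m f) • (MvPolynomial.monomial m (1 : K)) := by
    rw [MvPolynomial.smul_monomial, smul_eq_mul, mul_one]
  rw [hc, Derivation.map_smul, MvPolynomial.coeff_smul, ← forest_toMultiset]
  by_contra h
  have h2 := weight_of_coeff_leafCut_forest j _
    (fun t _ e => weight_of_coeff_leafCut_X j t e) e (right_ne_zero_of_mul h)
  have h3 := weight_node_toMultiset j m
  rw [Tree.weight_node] at h3
  exact MvPolynomial.mem_support_iff.1 hm (hf m (by omega))

theorem coeff_leafCut_congr (j : D) (f g : TreeAlgebra K D) (e : Tree D →₀ ℕ)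
    (h : ∀ m, forestWeight m = forestWeight e + 1 →
      MvPolynomial.coeff m f = MvPolynomial.coeff m g) :
    MvPolynomial.coeff e (leafCut K j f) = MvPolynomial.coeff e (leafCut K j g) := by
  rw [← sub_eq_zero, ← MvPolynomial.coeff_sub, ← map_sub]
  exact coeff_leafCut_eq_zero j _ e fun m hm => by
    rw [MvPolynomial.coeff_sub, h m hm, sub_self]

end LeafCut

/-! ### The coefficients of a Hopf system -/

section Relations

variable {K : Type v} [Field K] {I : Type u} [Fintype I]

theorem solution_eq_graft (F : I → MvPowerSeries I K) (i : I) :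
    solution F i = graft i (MvPowerSeries.subst (solution F) (F i)) :=
  (isSolution_iff F (solution F)).2 rfl i

theorem constantCoeff_solution (F : I → MvPowerSeries I K) (i : I) :
    MvPowerSeries.constantCoeff (solution F i) = 0 := by
  rw [solution_eq_graft]; exact constantCoeff_graft _ _

theorem component_zero_solution (F : I → MvPowerSeries I K) (i : I) :
    component 0 (solution F i) = 0 := by
  ext m
  rw [coeff_component, MvPolynomial.coeff_zero]
  split_ifs with h
  · exact agree_zero (constantCoeff_solution F i) (by simp : MvPowerSeries.constantCoeff
      (0 : CompletedTreeAlgebra K I) = 0) m h.le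
  · rfl

theorem component_succ_solution (F : I → MvPowerSeries I K) (n : ℕ) (i : I) :
    component (n + 1) (solution F i) =
      graftPoly K i (component n (MvPowerSeries.subst (solution F) (F i))) := by
  ext m
  rw [coeff_component]
  by_cases h : ∃ e : Tree I →₀ ℕ, m = Finsupp.single (Tree.node i (Finsupp.toMultiset e)) 1
  · obtain ⟨e, rfl⟩ := h
    rw [coeff_graftPoly, coeff_component, solution_eq_graft, coeff_graft,
      forestWeight_single, weight_node_toMultiset, add_comm 1]
    simp
  · push Not at h
    rw [coeff_graftPoly_of_ne _ _ _ h, solution_eq_graft, coeff_graft_of_ne _ _ _ h, ite_self]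

/-- The sum of the homogeneous components of degree at most `n` of the solution. -/
noncomputable def solutionTrunc (F : I → MvPowerSeries I K) (n : ℕ) (i : I) : TreeAlgebra K I :=
  ∑ m ∈ Finset.range (n + 1), component m (solution F i)

theorem coeff_solutionTrunc (F : I → MvPowerSeries I K) (n : ℕ) (i : I) (m : Tree I →₀ ℕ) :
    MvPolynomial.coeff m (solutionTrunc F n i) =
      if forestWeight m ≤ n then MvPowerSeries.coeff m (solution F i) else 0 := by
  rw [solutionTrunc, MvPolynomial.coeff_sum]
  simp only [coeff_component]
  rw [Finset.sum_ite_eq]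
  simp

theorem agree_solutionTrunc (F : I → MvPowerSeries I K) (n : ℕ) (i : I) :
    Agree n (solution F i) (solutionTrunc F n i : MvPowerSeries (Tree I) K) := by
  intro m hm
  rw [MvPolynomial.coeff_coe, coeff_solutionTrunc, if_pos hm]

theorem constantCoeff_solutionTrunc (F : I → MvPowerSeries I K) (n : ℕ) (i : I) :
    MvPowerSeries.constantCoeff (solutionTrunc F n i : MvPowerSeries (Tree I) K) = 0 := by
  rw [← MvPowerSeries.coeff_zero_eq_constantCoeff_apply, ← agree_solutionTrunc F n i 0 (by simp),
    MvPowerSeries.coeff_zero_eq_constantCoeff_apply, constantCoeff_solution]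

theorem degree_le_forestWeight {D : Type u} (e : Tree D →₀ ℕ) : e.degree ≤ forestWeight e := by
  rw [forestWeight, Finsupp.weight_apply, Finsupp.degree_apply, Finsupp.sum]
  exact Finset.sum_le_sum fun t _ => Nat.le_mul_of_pos_right _ t.weight_pos

/-- A polynomial with the same components of degree at most `n` as `F_i(X_j, j ∈ I)`. -/
noncomputable def insertion (F : I → MvPowerSeries I K) (n : ℕ) (i : I) : TreeAlgebra K I :=
  MvPolynomial.aeval (solutionTrunc F n) (MvPowerSeries.truncTotal (n + 1) (F i))

/-- The `X_k` have no constant term, so the terms of `F_i` of degree greater than `n` only produce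
forests with more than `n` vertices. Polynomials thus suffice, and the derivation can be applied to
them. -/
theorem coeff_insertion (F : I → MvPowerSeries I K) (n : ℕ) (i : I) (e : Tree I →₀ ℕ)
    (he : forestWeight e ≤ n) :
    MvPolynomial.coeff e (insertion F n i) =
      MvPowerSeries.coeff (Finsupp.single (Tree.node i (Finsupp.toMultiset e)) 1)
        (solution F i) := by
  have hc := constantCoeff_solutionTrunc F n
  have hs := MvPowerSeries.hasSubst_of_constantCoeff_zero hc
  rw [solution_eq_graft, coeff_graft, Agree.subst (constantCoeff_solution F) hc
    (agree_solutionTrunc F n) (F i) e he]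
  have h1 : ((insertion F n i : TreeAlgebra K I) : MvPowerSeries (Tree I) K) =
      MvPowerSeries.subst (fun k => (solutionTrunc F n k : MvPowerSeries (Tree I) K))
        (MvPowerSeries.truncTotal (n + 1) (F i) : MvPowerSeries I K) := by
    rw [MvPowerSeries.subst_coe, insertion]
    have := MvPolynomial.comp_aeval_apply (solutionTrunc F n)
      (MvPolynomial.coeToMvPowerSeries.algHom (σ := Tree I) (R := K) K)
      (MvPowerSeries.truncTotal (n + 1) (F i))
    simpa using this
  rw [← MvPolynomial.coeff_coe, h1, ← sub_eq_zero, ← map_sub, ← MvPowerSeries.subst_sub hs]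
  refine MvPowerSeries.coeff_of_lt_order (lt_of_lt_of_le ?_ (MvPowerSeries.le_order_subst hs _))
  have h2 : ((n + 1 : ℕ) : ℕ∞) ≤ ((MvPowerSeries.truncTotal (n + 1) (F i) : MvPowerSeries I K) -
      F i).order := by
    refine MvPowerSeries.nat_le_order fun d hd => ?_
    rw [map_sub, MvPolynomial.coeff_coe, MvPowerSeries.coeff_truncTotal _ hd, sub_self]
  have h3 : (1 : ℕ∞) ≤ ⨅ k, (solutionTrunc F n k : MvPowerSeries (Tree I) K).order :=
    le_iInf fun k => MvPowerSeries.one_le_order_iff_constCoeff_eq_zero.2 (hc k)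
  calc (e.degree : ℕ∞) < ((n + 1 : ℕ) : ℕ∞) := by
        exact_mod_cast Nat.lt_succ_of_le ((degree_le_forestWeight e).trans he)
    _ = 1 * ((n + 1 : ℕ) : ℕ∞) := (one_mul _).symm
    _ ≤ _ := mul_le_mul' h3 h2

theorem coeff_solution_leaf (F : I → MvPowerSeries I K) (k : I) :
    MvPowerSeries.coeff (Finsupp.single (Tree.node k 0) 1) (solution F k) =
      MvPowerSeries.constantCoeff (F k) := by
  have h := coeff_insertion F 0 k 0 (by simp)
  rw [map_zero] at h
  have hz : ∀ i, MvPolynomial.constantCoeff (solutionTrunc F 0 i) = 0 := fun i => by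
    rw [MvPolynomial.constantCoeff_eq, ← MvPolynomial.coeff_coe,
      MvPowerSeries.coeff_zero_eq_constantCoeff_apply, constantCoeff_solutionTrunc]
  have hc : ∀ p : MvPolynomial I K, MvPolynomial.constantCoeff
      (MvPolynomial.aeval (solutionTrunc F 0) p) = MvPolynomial.constantCoeff p := by
    intro p
    induction p using MvPolynomial.induction_on with
    | C a => simp [MvPolynomial.algebraMap_eq]
    | add p q hp hq => simp only [map_add, hp, hq]
    | mul_X p i hp => simp [hz]
  rw [← h, ← MvPolynomial.constantCoeff_eq, insertion, hc, MvPolynomial.constantCoeff_eq,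
    MvPowerSeries.coeff_truncTotal _ (by simp), MvPowerSeries.coeff_zero_eq_constantCoeff_apply]

/-- The linear part of a product is linear part times constant term, so products of generators
contribute nothing new on single trees. Among the generators, only the degree `n` component of `X_i`
contains trees with root `i` and weight `n`. -/
theorem exists_coeff_eq_mul (F : I → MvPowerSeries I K) {a : TreeAlgebra K I}
    (ha : a ∈ generatedSubalgebra F) (n : ℕ) (i : I) :
    ∃ c : K, ∀ t : Tree I, t.weight = n → t.root = i →
      MvPolynomial.coeff (Finsupp.single t 1) a =
        c * MvPowerSeries.coeff (Finsupp.single t 1) (solution F i) := by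
  classical
  induction ha using Algebra.adjoin_induction with
  | mem x hx =>
    obtain ⟨⟨k, m⟩, rfl⟩ := hx
    by_cases h : k = i ∧ m = n
    · obtain ⟨rfl, rfl⟩ := h
      refine ⟨1, fun t ht _ => ?_⟩
      rw [coeff_component, if_pos (by rw [forestWeight_single, ht]),
        one_mul]
    · refine ⟨0, fun t ht hr => ?_⟩
      simp only [coeff_component, zero_mul]
      split_ifs with hw
      · rw [forestWeight_single, ht] at hw
        rw [solution_eq_graft]
        refine coeff_graft_of_ne _ _ _ fun e he => h ⟨?_, hw.symm⟩
        rw [← hr, (Finsupp.single_left_injective (one_ne_zero)) he, Tree.root_node]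
      · rfl
  | algebraMap r =>
    refine ⟨0, fun t _ _ => ?_⟩
    rw [MvPolynomial.algebraMap_eq, MvPolynomial.coeff_C, if_neg, zero_mul]
    intro h
    simpa using DFunLike.congr_fun h t
  | add x y _ _ hx hy =>
    obtain ⟨c, hc⟩ := hx
    obtain ⟨c', hc'⟩ := hy
    exact ⟨c + c', fun t ht hr => by
      rw [MvPolynomial.coeff_add, hc t ht hr, hc' t ht hr, add_mul]⟩
  | mul x y _ _ hx hy =>
    obtain ⟨c, hc⟩ := hx
    obtain ⟨c', hc'⟩ := hy
    exact ⟨c * MvPolynomial.coeff 0 y + MvPolynomial.coeff 0 x * c', fun t ht hr => by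
      rw [coeff_single_mul, hc t ht hr, hc' t ht hr]; ring⟩

theorem exists_leafCut_eq (F : I → MvPowerSeries I K) (hF : IsHopf F) :
    ∃ l : ℕ → I → I → K, ∀ (j : I) (t : Tree I),
      MvPolynomial.coeff (Finsupp.single t 1)
        (leafCut K j (component (t.weight + 1) (solution F t.root))) =
      l t.weight t.root j * MvPowerSeries.coeff (Finsupp.single t 1) (solution F t.root) := by
  have h : ∀ (n : ℕ) (i j : I), leafCut K j (component (n + 1) (solution F i)) ∈
      generatedSubalgebra F := fun n i j =>
    leafCut_mem hF j (Algebra.subset_adjoin ⟨(i, n + 1), rfl⟩)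
  choose l hl using fun (n : ℕ) (i j : I) => exists_coeff_eq_mul F (h n i j) n i
  exact ⟨l, fun j t => hl _ _ j t rfl rfl⟩

theorem derivation_aeval {R : Type*} [CommRing R] [Algebra K R] (d : Derivation K R R)
    (x : I → R) (f : MvPolynomial I K) :
    d (MvPolynomial.aeval x f) =
      ∑ k, MvPolynomial.aeval x (MvPolynomial.pderiv k f) * d (x k) := by
  classical
  induction f using MvPolynomial.induction_on with
  | C a => simp
  | add p q hp hq => simp only [map_add, hp, hq, add_mul, Finset.sum_add_distrib]
  | mul_X p i hp =>
    simp only [map_mul, MvPolynomial.aeval_X, Derivation.leibniz, hp, smul_eq_mul, map_add,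
      MvPolynomial.pderiv_X, add_mul, Finset.sum_add_distrib, Finset.mul_sum]
    congr 1
    · rw [Finset.sum_eq_single i]
      · simp
      · intro k _ hk; simp [hk.symm]
      · simp
    · exact Finset.sum_congr rfl fun k _ => by ring

/-! ### Restriction to one chosen tree for each root. -/

/-- The forests of `f` are trees with root decorated by `k`. -/
def IsPlanted (k : I) (f : TreeAlgebra K I) : Prop :=
  ∀ m : Tree I →₀ ℕ, (∀ t : Tree I, t.root = k → m ≠ Finsupp.single t 1) →
    MvPolynomial.coeff m f = 0

omit [Fintype I] in
theorem isPlanted_graftPoly (k : I) (f : TreeAlgebra K I) : IsPlanted k (graftPoly K k f) :=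
  fun m hm => coeff_graftPoly_of_ne k f m fun _ => hm _ (Tree.root_node _ _)

theorem isPlanted_component (F : I → MvPowerSeries I K) (n : ℕ) (k : I) :
    IsPlanted k (component n (solution F k)) := by
  cases n with
  | zero => rw [component_zero_solution]; intro m _; simp
  | succ n => rw [component_succ_solution]; exact isPlanted_graftPoly _ _

omit [Fintype I] in
theorem injective_of_root {s : I → Tree I} (hs : ∀ k, (s k).root = k) : Function.Injective s :=
  fun a b h => by rw [← hs a, ← hs b, h]

/-- Only trees with root `k` occur in `f`, and `s k` is the only chosen tree with that root. -/
theorem killCompl_of_isPlanted {s : I → Tree I} (hs : ∀ k, (s k).root = k) {k : I}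
    {f : TreeAlgebra K I} (hf : IsPlanted k f) :
    MvPolynomial.killCompl (injective_of_root hs) f =
      MvPolynomial.C (MvPolynomial.coeff (Finsupp.single (s k) 1) f) * MvPolynomial.X k := by
  classical
  ext p
  rw [MvPolynomial.coeff_killCompl, MvPolynomial.coeff_C_mul, MvPolynomial.coeff_X]
  by_cases hp : Finsupp.single k 1 = p
  · subst hp; simp
  · rw [if_neg hp, mul_zero]
    refine hf _ fun t ht h => hp ?_
    have hinj := injective_of_root hs
    have h1 : ∀ x, p x = (Finsupp.single t 1 : Tree I →₀ ℕ) (s x) := fun x => by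
      rw [← h, Finsupp.mapDomain_apply hinj]
    obtain ⟨x, hx⟩ : ∃ x, t = s x := by
      by_contra! hne
      have : p = 0 := Finsupp.ext fun x => by rw [h1, Finsupp.single_eq_of_ne (hne x).symm]; rfl
      rw [this, Finsupp.mapDomain_zero] at h
      simpa using DFunLike.congr_fun h t
    subst hx
    rw [hs] at ht
    subst ht
    ext y
    rw [h1, Finsupp.single_apply, Finsupp.single_apply, hinj.eq_iff]

theorem killCompl_component (F : I → MvPowerSeries I K) {s : I → Tree I}
    (hs : ∀ k, (s k).root = k) (n : ℕ) (k : I) :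
    MvPolynomial.killCompl (injective_of_root hs) (component n (solution F k)) =
      if (s k).weight = n then
        MvPolynomial.C (MvPowerSeries.coeff (Finsupp.single (s k) 1) (solution F k)) *
          MvPolynomial.X k
      else 0 := by
  rw [killCompl_of_isPlanted hs (isPlanted_component F n k), coeff_component,
    forestWeight_single]
  split_ifs <;> simp

theorem killCompl_solutionTrunc (F : I → MvPowerSeries I K) {s : I → Tree I}
    (hs : ∀ k, (s k).root = k) (n : ℕ) (k : I) (hn : (s k).weight ≤ n) :
    MvPolynomial.killCompl (injective_of_root hs) (solutionTrunc F n k) =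
      MvPolynomial.C (MvPowerSeries.coeff (Finsupp.single (s k) 1) (solution F k)) *
          MvPolynomial.X k := by
  rw [solutionTrunc, map_sum]
  simp only [killCompl_component F hs]
  rw [Finset.sum_ite_eq, if_pos (Finset.mem_range.2 (Nat.lt_succ_of_le hn))]

/-- The constant comes from the degree one component, the single vertex `k`, when `k = j`. The
remaining part is planted, hence reduces to the coefficient of `s k`, which `hl` evaluates. -/
theorem killCompl_leafCut_component [DecidableEq I] (F : I → MvPowerSeries I K)
    (hF1 : ∀ i, MvPowerSeries.constantCoeff (F i) = 1) {l : ℕ → I → I → K}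
    (hl : ∀ (j : I) (t : Tree I), MvPolynomial.coeff (Finsupp.single t 1)
        (leafCut K j (component (t.weight + 1) (solution F t.root))) =
      l t.weight t.root j * MvPowerSeries.coeff (Finsupp.single t 1) (solution F t.root))
    {s : I → Tree I} (hs : ∀ k, (s k).root = k) (n : ℕ) (j k : I) :
    MvPolynomial.killCompl (injective_of_root hs)
        (leafCut K j (component (n + 1) (solution F k))) =
      (if n = 0 ∧ k = j then 1 else 0) + if (s k).weight = n then
        MvPolynomial.C (l n k j * MvPowerSeries.coeff (Finsupp.single (s k) 1) (solution F k)) *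
          MvPolynomial.X k else 0 := by
  have h0 : MvPolynomial.coeff 0 (component n (MvPowerSeries.subst (solution F) (F k))) =
      if n = 0 then (1 : K) else 0 := by
    rw [coeff_component, map_zero]
    by_cases hn : n = 0
    · rw [if_pos hn.symm, if_pos hn, ← coeff_graft k, ← solution_eq_graft, map_zero,
        coeff_solution_leaf, hF1]
    · rw [if_neg (Ne.symm hn), if_neg hn]
  have hplanted := isPlanted_graftPoly k
    (leafCut K j (component n (MvPowerSeries.subst (solution F) (F k))))
  have hcoeff : MvPolynomial.coeff (Finsupp.single (s k) 1) (graftPoly K k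
      (leafCut K j (component n (MvPowerSeries.subst (solution F) (F k))))) =
      MvPolynomial.coeff (Finsupp.single (s k) 1)
        (leafCut K j (component (n + 1) (solution F k))) := by
    rw [component_succ_solution, leafCut_graftPoly, MvPolynomial.coeff_add]
    classical
    have : MvPolynomial.coeff (Finsupp.single (s k) 1) (if k = j then MvPolynomial.C
        (MvPolynomial.coeff 0 (component n (MvPowerSeries.subst (solution F) (F k)))) else 0 :
          TreeAlgebra K I) = 0 := by
      split_ifs
      · rw [MvPolynomial.coeff_C, if_neg]
        intro h
        simpa using DFunLike.congr_fun h (s k)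
      · simp
    rw [this, add_zero]
  rw [component_succ_solution, leafCut_graftPoly, map_add, killCompl_of_isPlanted hs hplanted,
    hcoeff, add_comm]
  congr 1
  · rw [h0]
    by_cases hk : k = j <;> by_cases hn : n = 0 <;> simp [hk, hn]
  · split_ifs with hn
    · have := hl j (s k)
      rw [hs, hn] at this
      rw [this]
    · rw [coeff_leafCut_eq_zero, map_zero, zero_mul]
      intro m hm
      rw [coeff_component, if_neg]
      rw [hm, forestWeight_single]
      omega

/-- The bound on the weight is strict because leaf cutting reaches `s k` from the component with one
more vertex. -/
theorem killCompl_leafCut_solutionTrunc [DecidableEq I] (F : I → MvPowerSeries I K)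
    (hF1 : ∀ i, MvPowerSeries.constantCoeff (F i) = 1) {l : ℕ → I → I → K}
    (hl : ∀ (j : I) (t : Tree I), MvPolynomial.coeff (Finsupp.single t 1)
        (leafCut K j (component (t.weight + 1) (solution F t.root))) =
      l t.weight t.root j * MvPowerSeries.coeff (Finsupp.single t 1) (solution F t.root))
    {s : I → Tree I} (hs : ∀ k, (s k).root = k) (n : ℕ) (j k : I) (hn : (s k).weight < n) :
    MvPolynomial.killCompl (injective_of_root hs) (leafCut K j (solutionTrunc F n k)) =
      (if k = j then 1 else 0) + MvPolynomial.C (l (s k).weight k j *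
        MvPowerSeries.coeff (Finsupp.single (s k) 1) (solution F k)) * MvPolynomial.X k := by
  rw [solutionTrunc, Finset.sum_range_succ', component_zero_solution, add_zero, map_sum, map_sum]
  simp only [killCompl_leafCut_component F hF1 hl hs]
  rw [Finset.sum_add_distrib]
  congr 1
  · rw [Finset.sum_eq_single_of_mem 0 (Finset.mem_range.2 (by omega))]
    · simp
    · intro m _ hm; simp [hm]
  · rw [Finset.sum_ite_eq, if_pos (Finset.mem_range.2 hn)]

omit [Fintype I] in
theorem coeff_aeval_C_mul_X (c : I → K) (g : MvPolynomial I K) (p : I →₀ ℕ) :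
    MvPolynomial.coeff p (MvPolynomial.aeval (fun k => MvPolynomial.C (c k) * MvPolynomial.X k) g :
      MvPolynomial I K) = (p.prod fun k n => c k ^ n) * MvPolynomial.coeff p g := by
  classical
  induction g using MvPolynomial.induction_on' with
  | add f g hf hg => rw [map_add, MvPolynomial.coeff_add, MvPolynomial.coeff_add, hf, hg, mul_add]
  | monomial m a =>
    have : (m.prod fun k n => (MvPolynomial.C (c k) * MvPolynomial.X k) ^ n : MvPolynomial I K) =
        MvPolynomial.monomial m (m.prod fun k n => c k ^ n) := by
      rw [MvPolynomial.monomial_eq, Finsupp.prod, Finsupp.prod, Finsupp.prod, map_prod,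
        ← Finset.prod_mul_distrib]
      simp [mul_pow]
    rw [MvPolynomial.aeval_monomial, this, MvPolynomial.algebraMap_eq, MvPolynomial.C_mul_monomial,
      MvPolynomial.coeff_monomial, MvPolynomial.coeff_monomial]
    split_ifs with h
    · rw [h, mul_comm]
    · rw [mul_zero]

/-- The restriction of the polynomials to the chosen trees `s k`, which are rescaled in such a
way that the solution becomes the family of the indeterminates. -/
noncomputable def restriction (F : I → MvPowerSeries I K) {s : I → Tree I}
    (hs : ∀ k, (s k).root = k) : TreeAlgebra K I →ₐ[K] MvPolynomial I K :=
  (MvPolynomial.aeval fun k => MvPolynomial.C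
    (MvPowerSeries.coeff (Finsupp.single (s k) 1) (solution F k))⁻¹ * MvPolynomial.X k).comp
      (MvPolynomial.killCompl (injective_of_root hs))

omit [Fintype I] in
theorem coeff_restriction (F : I → MvPowerSeries I K) {s : I → Tree I}
    (hs : ∀ k, (s k).root = k) (g : TreeAlgebra K I) (p : I →₀ ℕ) :
    MvPolynomial.coeff p (restriction F hs g) =
      (p.prod fun k n => (MvPowerSeries.coeff (Finsupp.single (s k) 1) (solution F k))⁻¹ ^ n) *
        MvPolynomial.coeff (Finsupp.mapDomain s p) g := by
  rw [restriction, AlgHom.comp_apply, coeff_aeval_C_mul_X, MvPolynomial.coeff_killCompl]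

theorem restriction_aeval (F : I → MvPowerSeries I K) {s : I → Tree I}
    (hs : ∀ k, (s k).root = k)
    (h0 : ∀ k, MvPowerSeries.coeff (Finsupp.single (s k) 1) (solution F k) ≠ 0) (n : ℕ)
    (hn : ∀ k, (s k).weight ≤ n) (g : MvPolynomial I K) :
    restriction F hs (MvPolynomial.aeval (solutionTrunc F n) g) = g := by
  have : (restriction F hs).comp (MvPolynomial.aeval (solutionTrunc F n)) = AlgHom.id K _ := by
    refine MvPolynomial.algHom_ext fun k => ?_
    rw [AlgHom.comp_apply, MvPolynomial.aeval_X, restriction, AlgHom.comp_apply,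
      killCompl_solutionTrunc F hs n k (hn k), map_mul, MvPolynomial.aeval_X, ← mul_assoc]
    simp only [← MvPolynomial.algebraMap_eq, AlgHom.commutes]
    rw [← map_mul, mul_inv_cancel₀ (h0 k), map_one, one_mul, AlgHom.id_apply]
  exact congrArg (fun φ => φ g) this

/-- After restriction the insertion becomes `F_i` itself, so this coefficient is, up to the
rescaling factors, the coefficient of `p` in `F_i`. -/
theorem coeff_solution_node (F : I → MvPowerSeries I K) {s : I → Tree I}
    (hs : ∀ k, (s k).root = k)
    (h0 : ∀ k, MvPowerSeries.coeff (Finsupp.single (s k) 1) (solution F k) ≠ 0) (i : I)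
    (p : I →₀ ℕ) (hp : MvPowerSeries.coeff p (F i) ≠ 0) :
    MvPowerSeries.coeff (Finsupp.single (Tree.node i
      (Finsupp.toMultiset (Finsupp.mapDomain s p))) 1) (solution F i) ≠ 0 := by
  set n := forestWeight (Finsupp.mapDomain s p) + p.degree + ∑ k, (s k).weight with hn
  have hw : ∀ k, (s k).weight ≤ n := fun k =>
    (Finset.single_le_sum (f := fun k => (s k).weight) (fun _ _ => Nat.zero_le _)
      (Finset.mem_univ k)).trans (by omega)
  rw [← coeff_insertion F n i _ (by omega)]
  have h := coeff_restriction F hs (insertion F n i) p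
  rw [insertion, restriction_aeval F hs h0 n hw, MvPowerSeries.coeff_truncTotal _ (by omega)] at h
  intro h'
  rw [insertion] at h'
  rw [h', mul_zero] at h
  exact hp h

/-- The coefficient of the tree `B_i(∏ s_k^{p_k})` after cutting a leaf `j` is computed in two ways:
by `hl`, and by the chain rule for the restricted derivation `h_k ↦ δ_kj + l (s k).weight k j * h_k`
applied to `F_i`. -/
theorem coeff_relation (F : I → MvPowerSeries I K)
    (hF1 : ∀ i, MvPowerSeries.constantCoeff (F i) = 1) {l : ℕ → I → I → K}
    (hl : ∀ (j : I) (t : Tree I), MvPolynomial.coeff (Finsupp.single t 1)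
        (leafCut K j (component (t.weight + 1) (solution F t.root))) =
      l t.weight t.root j * MvPowerSeries.coeff (Finsupp.single t 1) (solution F t.root))
    {s : I → Tree I} (hs : ∀ k, (s k).root = k)
    (h0 : ∀ k, MvPowerSeries.coeff (Finsupp.single (s k) 1) (solution F k) ≠ 0)
    (i j : I) (p : I →₀ ℕ) :
    (p j + 1) * MvPowerSeries.coeff (p + Finsupp.single j 1) (F i) +
        (∑ k, p k * l (s k).weight k j) * MvPowerSeries.coeff p (F i) =
      l (1 + forestWeight (Finsupp.mapDomain s p)) i j * MvPowerSeries.coeff p (F i) := by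
  classical
  set q := Finsupp.mapDomain s p with hq
  -- Any truncation order works if it is large enough for all degrees met below; the extra 1 makes
  -- the weights of the `s k` strictly smaller.
  set n := forestWeight q + p.degree + (∑ k, (s k).weight) + 1 with hn
  have hw : ∀ k, (s k).weight < n := fun k =>
    (Finset.single_le_sum (f := fun k => (s k).weight) (fun _ _ => Nat.zero_le _)
      (Finset.mem_univ k)).trans_lt (by omega)
  set G := MvPowerSeries.truncTotal (n + 1) (F i) with hG
  have hGc : ∀ m : I →₀ ℕ, m.degree ≤ n → MvPolynomial.coeff m G = MvPowerSeries.coeff m (F i) :=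
    fun m hm => MvPowerSeries.coeff_truncTotal _ (by omega)
  have h1 : MvPolynomial.coeff q (leafCut K j (insertion F n i)) =
      l (1 + forestWeight q) i j * MvPolynomial.coeff q (insertion F n i) := by
    have hroot : (Tree.node i (Finsupp.toMultiset q)).weight = 1 + forestWeight q :=
      weight_node_toMultiset i q
    have e1 := hl j (Tree.node i (Finsupp.toMultiset q))
    rw [Tree.root_node, hroot, ← coeff_insertion F n i q (by omega)] at e1
    rw [← e1, ← coeff_graftPoly i]
    -- Leaf cutting only sees forests with exactly one more vertex, and there the component of `X_i`
    -- and the grafted insertion coincide.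
    have e2 := coeff_leafCut_congr j (component (1 + forestWeight q + 1) (solution F i))
      (graftPoly K i (insertion F n i))
      (Finsupp.single (Tree.node i (Finsupp.toMultiset q)) 1) (fun m hm => by
        rw [forestWeight_single, hroot] at hm
        rw [coeff_component, if_pos hm]
        by_cases h : ∃ e : Tree I →₀ ℕ, m = Finsupp.single (Tree.node i (Finsupp.toMultiset e)) 1
        · obtain ⟨e, rfl⟩ := h
          rw [forestWeight_single, weight_node_toMultiset] at hm
          rw [coeff_graftPoly, coeff_insertion F n i e (by omega)]
        · push Not at h
          rw [coeff_graftPoly_of_ne _ _ _ h, solution_eq_graft, coeff_graft_of_ne _ _ _ h])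
    rw [e2, leafCut_graftPoly, MvPolynomial.coeff_add, left_eq_add]
    split_ifs
    · rw [MvPolynomial.coeff_C, if_neg]
      intro h
      simpa using DFunLike.congr_fun h (Tree.node i (Finsupp.toMultiset q))
    · simp
  have h2 : MvPolynomial.coeff p (restriction F hs (leafCut K j (insertion F n i))) =
      l (1 + forestWeight q) i j * MvPolynomial.coeff p (restriction F hs (insertion F n i)) := by
    rw [coeff_restriction, coeff_restriction, h1]; ring
  have hD : ∀ k, restriction F hs (leafCut K j (solutionTrunc F n k)) =
      (if k = j then 1 else 0) + MvPolynomial.C (l (s k).weight k j) * MvPolynomial.X k := by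
    intro k
    rw [restriction, AlgHom.comp_apply, killCompl_leafCut_solutionTrunc F hF1 hl hs n j k (hw k),
      map_add, map_mul, MvPolynomial.aeval_X, ← mul_assoc]
    simp only [← MvPolynomial.algebraMap_eq, AlgHom.commutes]
    rw [← map_mul, mul_assoc, mul_inv_cancel₀ (h0 k), mul_one]
    congr 1
    split_ifs <;> simp
  rw [insertion, derivation_aeval, map_sum] at h2
  simp only [map_mul, restriction_aeval F hs h0 n (fun k => (hw k).le), hD] at h2
  rw [hGc p (by omega)] at h2
  rw [← h2, MvPolynomial.coeff_sum]
  simp only [mul_add, MvPolynomial.coeff_add, Finset.sum_add_distrib]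
  congr 1
  · rw [Finset.sum_eq_single j]
    · rw [if_pos rfl, mul_one, MvPolynomial.coeff_pderiv, hGc _ (by simp; omega)]
      simp [mul_comm]
    · intro k _ hk; simp [hk]
    · simp
  · rw [Finset.sum_mul]
    refine Finset.sum_congr rfl fun k _ => ?_
    rw [mul_left_comm, MvPolynomial.coeff_C_mul, MvPolynomial.coeff_mul_X']
    split_ifs with hk
    · have hle : Finsupp.single k 1 ≤ p := by
        rw [Finsupp.single_le_iff]
        exact Nat.one_le_iff_ne_zero.2 (Finsupp.mem_support_iff.1 hk)
      have h1k := Finsupp.single_le_iff.1 hle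
      rw [MvPolynomial.coeff_pderiv, tsub_add_cancel_of_le hle, hGc p (by omega)]
      simp only [Finsupp.coe_tsub, Pi.sub_apply, Finsupp.single_eq_same]
      rw [Nat.cast_sub h1k]
      push_cast
      ring
    · rw [Finsupp.notMem_support_iff.1 hk]; simp

end Relations

/-! ### The recurrences for trees of equal weight. -/

section Multipliers

variable {K : Type v} [Field K] {I : Type u} [Fintype I]

/-- The relations between the coefficients of a Hopf system, for trees of the same weight. -/
def IsMultiplier (a : I → (I →₀ ℕ) → K) (l : ℕ → I → I → K) : Prop :=
  ∀ m, 1 ≤ m → ∀ (i j : I) (p : I →₀ ℕ), (p j + 1) * a i (p + Finsupp.single j 1) +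
    (∑ k, p k * l m k j) * a i p = l (1 + m * p.degree) i j * a i p

omit [Fintype I] in
theorem forestWeight_mapDomain {s : I → Tree I} {m : ℕ} (hs : ∀ k, (s k).weight = m)
    (p : I →₀ ℕ) : forestWeight (Finsupp.mapDomain s p) = m * p.degree := by
  induction p using Finsupp.induction_linear with
  | zero => simp
  | add f g hf hg => rw [Finsupp.mapDomain_add, map_add, hf, hg, map_add, mul_add]
  | single k n =>
    rw [Finsupp.mapDomain_single, forestWeight, Finsupp.weight_single, hs, smul_eq_mul,
      Finsupp.degree_single, mul_comm]

-- The factor `p j + 1` is invertible in characteristic zero, so a vanishing coefficient forces all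
-- the higher ones to vanish. In particular, edges of the graph can be read on the linear terms.
omit [Fintype I] in
theorem coeff_add_eq_zero [CharZero K] {f : (I →₀ ℕ) → K} {r : I → (I →₀ ℕ) → K}
    (h : ∀ j (p : I →₀ ℕ), (p j + 1 : K) * f (p + Finsupp.single j 1) = r j p * f p)
    (p q : I →₀ ℕ) (hp : f p = 0) : f (p + q) = 0 := by
  induction q using Finsupp.induction_linear generalizing p with
  | zero => simpa using hp
  | add q q' hq hq' => rw [← add_assoc]; exact hq' _ (hq _ hp)
  | single j n =>
    induction n with
    | zero => simpa using hp
    | succ n ih =>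
      have h1 := h j (p + Finsupp.single j n)
      rw [ih, mul_zero, mul_eq_zero] at h1
      rw [Finsupp.single_add, ← add_assoc]
      exact h1.resolve_left (Nat.cast_add_one_ne_zero _)

theorem IsMultiplier.add_eq_zero [CharZero K] {a : I → (I →₀ ℕ) → K} {l : ℕ → I → I → K}
    (h : IsMultiplier a l) (i : I) (p q : I →₀ ℕ) (hp : a i p = 0) : a i (p + q) = 0 :=
  coeff_add_eq_zero (r := fun j p => l (1 + 1 * p.degree) i j - ∑ k, p k * l 1 k j)
    (fun j p => by rw [sub_mul, ← h 1 le_rfl i j p]; ring) p q hp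

/-- To apply `coeff_relation` in every weight `m`, trees of weight `m` with nonzero coefficient are
needed for every root. Ladders provide them, since each `F_i`, being non-constant, has a nonzero
linear coefficient. -/
theorem exists_isMultiplier [CharZero K] (F : I → MvPowerSeries I K)
    (hF : ∀ i, ∀ c : K, F i ≠ MvPowerSeries.C c)
    (hF1 : ∀ i, MvPowerSeries.constantCoeff (F i) = 1) (hHopf : IsHopf F) :
    (∃ l, IsMultiplier (fun i p => MvPowerSeries.coeff p (F i)) l) ∧
      ∀ i, ∃ j, MvPowerSeries.coeff (Finsupp.single j 1) (F i) ≠ 0 := by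
  obtain ⟨l, hl⟩ := exists_leafCut_eq F hHopf
  have rel : ∀ m, (∃ s : I → Tree I, (∀ k, (s k).root = k) ∧ (∀ k, (s k).weight = m) ∧
      ∀ k, MvPowerSeries.coeff (Finsupp.single (s k) 1) (solution F k) ≠ 0) →
      ∀ (i j : I) (p : I →₀ ℕ), (p j + 1) * MvPowerSeries.coeff (p + Finsupp.single j 1) (F i) +
        (∑ k, p k * l m k j) * MvPowerSeries.coeff p (F i) =
        l (1 + m * p.degree) i j * MvPowerSeries.coeff p (F i) := by
    rintro m ⟨s, hs, hw, h0⟩ i j p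
    have := coeff_relation F hF1 hl hs h0 i j p
    simpa only [hw, forestWeight_mapDomain hw] using this
  have leaf : ∃ s : I → Tree I, (∀ k, (s k).root = k) ∧ (∀ k, (s k).weight = 1) ∧
      ∀ k, MvPowerSeries.coeff (Finsupp.single (s k) 1) (solution F k) ≠ 0 := by
    refine ⟨fun k => Tree.node k 0, fun k => Tree.root_node _ _, fun k => ?_, fun k => ?_⟩
    · rw [Tree.weight_node]; simp
    · rw [coeff_solution_leaf, hF1]; exact one_ne_zero
  have lin : ∀ i, ∃ j, MvPowerSeries.coeff (Finsupp.single j 1) (F i) ≠ 0 := by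
    intro i
    by_contra! hne
    refine hF i (MvPowerSeries.constantCoeff (F i)) ?_
    ext p
    classical
    rw [MvPowerSeries.coeff_C]
    split_ifs with hp
    · rw [hp, MvPowerSeries.coeff_zero_eq_constantCoeff_apply]
    · obtain ⟨j, hj⟩ := Finsupp.ne_iff.1 hp
      have hle : Finsupp.single j 1 ≤ p := by
        rw [Finsupp.single_le_iff]; exact Nat.one_le_iff_ne_zero.2 hj
      rw [← add_tsub_cancel_of_le hle]
      exact coeff_add_eq_zero (f := fun p => MvPowerSeries.coeff p (F i))
        (r := fun j p => l (1 + 1 * p.degree) i j - ∑ k, p k * l 1 k j)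
        (fun j p => by rw [sub_mul, ← rel 1 leaf i j p]; ring) _ _ (hne j)
  refine ⟨⟨l, fun m hm => rel m ?_⟩, lin⟩
  induction m, hm using Nat.le_induction with
  | base => exact leaf
  | succ m _ ih =>
    obtain ⟨s, hs, hw, h0⟩ := ih
    choose n hn using lin
    -- The ladder of root `k` is extended by placing the ladder of root `n k` above it, where `h_{n
    -- k}` occurs linearly in `F_k`.
    refine ⟨fun k => Tree.node k (Finsupp.toMultiset (Finsupp.mapDomain s (Finsupp.single (n k) 1))),
      fun k => Tree.root_node _ _, fun k => ?_, fun k => coeff_solution_node F hs h0 k _ (hn k)⟩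
    rw [weight_node_toMultiset, forestWeight_mapDomain hw, Finsupp.degree_single]
    omega

theorem IsMultiplier.rescale {a : I → (I →₀ ℕ) → K} {l : ℕ → I → I → K}
    (h : IsMultiplier a l) (c : I → K) :
    IsMultiplier (fun i p => (p.prod fun k n => c k ^ n) * a i p) (fun m i j => c j * l m i j) := by
  intro m hm i j p
  have h1 : ((p + Finsupp.single j 1).prod fun k n => c k ^ n) =
      (p.prod fun k n => c k ^ n) * c j := by
    rw [Finsupp.prod_add_index' (by simp) (by intros; rw [pow_add])]
    simp
  have h2 : ∑ k, p k * (c j * l m k j) = c j * ∑ k, p k * l m k j := by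
    rw [Finset.mul_sum]; exact Finset.sum_congr rfl fun k _ => by ring
  beta_reduce
  rw [h1, h2]
  linear_combination (p.prod fun k n => c k ^ n) * c j * h m hm i j p

/-- The coefficients of a connected symmetric Hopf system, normalised by a change of variables. -/
structure IsNormalized (a : I → (I →₀ ℕ) → K) (l : ℕ → I → I → K) (E : I → I → Prop) : Prop where
  isMultiplier : IsMultiplier a l
  zero : ∀ i, a i 0 = 1
  of_adj : ∀ i j, E i j → a i (Finsupp.single j 1) = 1
  of_not_adj : ∀ i j, ¬ E i j → a i (Finsupp.single j 1) = 0
  symm : ∀ i j, E i j → E j i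
  irrefl : ∀ i, ¬ E i i
  exists_adj : ∀ i, ∃ j, E i j
  induct : ∀ (P : I → Prop) (i : I), P i → (∀ j k, P j → E j k → P k) → ∀ j, P j

/-! ### Multipliers of a normalized system. -/

namespace IsNormalized

variable {a : I → (I →₀ ℕ) → K} {l : ℕ → I → I → K} {E : I → I → Prop}

theorem multiplier_one (h : IsNormalized a l E) (i j : I) :
    l 1 i j = a i (Finsupp.single j 1) := by
  have := h.isMultiplier 1 le_rfl i j 0
  simpa [h.zero] using this.symm

/-- The recurrence at `p = e_k`. Its left side does not depend on the neighbour `k`, nor does the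
coefficient on the right depend on `m`; both facts are exploited repeatedly. -/
theorem multiplier_succ (h : IsNormalized a l E) {i k : I} (hik : E i k) (j : I) {m : ℕ}
    (hm : 1 ≤ m) : l (m + 1) i j = l m k j + ((Finsupp.single k 1 : I →₀ ℕ) j + 1) *
      a i (Finsupp.single k 1 + Finsupp.single j 1) := by
  have := h.isMultiplier m hm i j (Finsupp.single k 1)
  rw [Finset.sum_eq_single k (fun b _ hb => by simp [hb.symm]) (by simp), h.of_adj i k hik,
    Finsupp.degree_single, add_comm 1] at this
  simp only [Finsupp.single_eq_same, Nat.cast_one, one_mul, mul_one] at this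
  rw [← this, add_comm]

variable [CharZero K]

theorem eq_zero_of_not_adj (h : IsNormalized a l E) {i j : I} (hij : ¬ E i j) (q : I →₀ ℕ) :
    a i (Finsupp.single j 1 + q) = 0 :=
  h.isMultiplier.add_eq_zero i _ q (h.of_not_adj i j hij)

theorem multiplier_succ_of_not_adj (h : IsNormalized a l E) {i j k : I} (hik : E i k)
    (hij : ¬ E i j) {m : ℕ} (hm : 1 ≤ m) : l (m + 1) i j = l m k j := by
  rw [h.multiplier_succ hik j hm, add_comm (Finsupp.single k 1), h.eq_zero_of_not_adj hij, mul_zero,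
    add_zero]

/-- When `i` is not adjacent to `j`, `l 2 i j` is the coefficient of `h_j` in `F_k` for any
neighbour `k` of `i`, hence 0 or 1. It is 1 at `i = j` by symmetry, and the value 1 propagates along
the connected graph. -/
theorem multiplier_two (h : IsNormalized a l E) {i j : I} (hij : ¬ E i j) : l 2 i j = 1 := by
  refine (h.induct (fun i => E i j ∨ l 2 i j = 1) j ?_ ?_ i).resolve_left hij
  · obtain ⟨k, hk⟩ := h.exists_adj j
    right
    rw [h.multiplier_succ_of_not_adj hk (h.irrefl j) le_rfl, h.multiplier_one,
      h.of_adj k j (h.symm _ _ hk)]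
  · intro i k hi hik
    by_cases hkj : E k j
    · exact Or.inl hkj
    by_cases hij : E i j
    · right
      rw [h.multiplier_succ_of_not_adj (h.symm _ _ hik) hkj le_rfl, h.multiplier_one,
        h.of_adj i j hij]
    -- Here `k` is a neighbour of `i` not adjacent to `j`, which would give `l 2 i j = 0`.
    · have := hi.resolve_left hij
      rw [h.multiplier_succ_of_not_adj hik hij le_rfl, h.multiplier_one,
        h.of_not_adj k j hkj] at this
      exact absurd this zero_ne_one

/-- Nonadjacency is transitive. -/
theorem adj_of_not_adj (h : IsNormalized a l E) {i j k : I} (hij : ¬ E i j) (hik : E i k) :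
    E k j := by
  by_contra hkj
  have := h.multiplier_two hij
  rw [h.multiplier_succ_of_not_adj hik hij le_rfl, h.multiplier_one, h.of_not_adj k j hkj] at this
  exact zero_ne_one this

theorem multiplier_of_adj (h : IsNormalized a l E) {k j : I} (hkj : E k j) {n : ℕ} (hn : 1 ≤ n) :
    l n k j = l (n + 1) j j :=
  (h.multiplier_succ_of_not_adj (h.symm _ _ hkj) (h.irrefl j) hn).symm

omit [CharZero K] in
theorem multiplier_diag_one (h : IsNormalized a l E) (j : I) : l 1 j j = 0 := by
  rw [h.multiplier_one, h.of_not_adj j j (h.irrefl j)]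

theorem multiplier_diag_three (h : IsNormalized a l E) {k j : I} (hkj : E k j) :
    l 3 j j = 2 * a k (Finsupp.single j 1 + Finsupp.single j 1) := by
  rw [← h.multiplier_of_adj hkj (by omega : 1 ≤ 2), h.multiplier_succ hkj j le_rfl,
    h.multiplier_diag_one]
  norm_num

theorem multiplier_diag_add_two (h : IsNormalized a l E) (j : I) {n : ℕ} (hn : 1 ≤ n) :
    l (n + 2) j j = l n j j + l 3 j j := by
  obtain ⟨k, hk⟩ := h.exists_adj j
  have hkj := h.symm _ _ hk
  rw [← h.multiplier_of_adj hkj (by omega : 1 ≤ n + 1), h.multiplier_succ hkj j hn,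
    h.multiplier_diag_three hkj]
  norm_num

/-- Let `k` be a neighbour of `j`, `a` the coefficient of `h_j ^ 2` in `F_k` and `μ = l 3 j j = 2a`.
The recurrences at `p = 2 e_j` for `m = 1` and `m = 2` have the same leading term and give `(1 + μ)
a` and `(1 + 2μ) a - 2a` for it, so `μ (μ - 2) = 0`. -/
theorem multiplier_diag_three_eq (h : IsNormalized a l E) (j : I) : l 3 j j = 0 ∨ l 3 j j = 2 := by
  obtain ⟨k, hk⟩ := h.exists_adj j
  have hkj := h.symm _ _ hk
  have h2 := h.multiplier_two (h.irrefl j)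
  have h4 := h.multiplier_diag_add_two j (by omega : 1 ≤ 2)
  have h6 := h.multiplier_diag_add_two j (by omega : 1 ≤ 4)
  have hs : ∀ m, ∑ x, ((Finsupp.single j 1 + Finsupp.single j 1 : I →₀ ℕ) x : K) * l m x j =
      2 * l m j j := fun m => by
    rw [Finset.sum_eq_single j (fun b _ hb => by simp [hb.symm]) (by simp)]
    norm_num
  have e1 := h.isMultiplier 1 (by omega) k j (Finsupp.single j 1 + Finsupp.single j 1)
  have e2 := h.isMultiplier 2 (by omega) k j (Finsupp.single j 1 + Finsupp.single j 1)
  rw [hs] at e1 e2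
  simp only [map_add, Finsupp.degree_single] at e1 e2
  norm_num only at e1 e2
  rw [h.multiplier_of_adj hkj (by omega)] at e1 e2
  have h3 := h.multiplier_diag_three hkj
  have h1 := h.multiplier_diag_one j
  norm_num only at e1 e2 h4 h6
  rw [h4, h2, h1] at e1
  rw [h6, h4, h2] at e2
  have key : l 3 j j * (l 3 j j - 2) = 0 := by
    rw [← sub_eq_zero] at e1 e2
    linear_combination (l 3 j j - 2) * h3 + 2 * e1 - 2 * e2
  rcases mul_eq_zero.1 key with h0 | h0
  · exact Or.inl h0
  · exact Or.inr (sub_eq_zero.1 h0)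

/-- The recurrence of `F_i` at `p = 2 e_k` in the direction `i` has no leading term, since `F_i`
does not involve `h_i`. It can be divided by the coefficient of `h_k ^ 2`, which is half of `l 3 k
k`. -/
theorem multiplier_diag_three_of_adj (h : IsNormalized a l E) {i k : I} (hik : E i k)
    (hk : l 3 k k ≠ 0) : l 3 i i = 2 := by
  have hki := h.symm _ _ hik
  have e := h.isMultiplier 1 le_rfl i i (Finsupp.single k 1 + Finsupp.single k 1)
  rw [Finset.sum_eq_single k (fun b _ hb => by simp [hb.symm]) (by simp), h.multiplier_one,
    h.of_adj k i hki, add_comm _ (Finsupp.single i 1), h.eq_zero_of_not_adj (h.irrefl i)] at e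
  have h0 : a i (Finsupp.single k 1 + Finsupp.single k 1) ≠ 0 := fun h0 => hk (by
    rw [h.multiplier_diag_three hik, h0, mul_zero])
  simp only [map_add, Finsupp.degree_single, mul_zero, zero_add] at e
  have := mul_right_cancel₀ h0 e
  rw [← this]
  norm_num

theorem multiplier_diag_three_dichotomy (h : IsNormalized a l E) :
    (∀ j, l 3 j j = 0) ∨ ∀ j, l 3 j j = 2 := by
  by_cases h0 : ∀ j, l 3 j j = 0
  · exact Or.inl h0
  · push Not at h0
    obtain ⟨i, hi⟩ := h0
    refine Or.inr (h.induct (fun j => l 3 j j = 2) i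
      ((h.multiplier_diag_three_eq i).resolve_left hi) fun j k hj hjk => ?_)
    exact h.multiplier_diag_three_of_adj (h.symm _ _ hjk) (by rw [hj]; exact two_ne_zero)

/-- In a triangle, the coefficient of `h_k h_j` in `F_i` would be -1 by the recurrence for `m = 1`
and 1 by the one for `m = 2`. -/
theorem not_triangle (h : IsNormalized a l E) (h0 : ∀ j, l 3 j j = 0) {i j k : I} (hij : E i j)
    (hik : E i k) : ¬ E k j := by
  intro hkj
  have e1 := h.multiplier_succ hik j (by omega : 1 ≤ 1)
  have e2 := h.multiplier_succ hik j (by omega : 1 ≤ 2)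
  have h4 := h.multiplier_diag_add_two j (by omega : 1 ≤ 2)
  rw [h.multiplier_of_adj hij (by omega), h.multiplier_of_adj hkj (by omega)] at e1 e2
  norm_num only at e1 e2 h4
  rw [h0] at e1
  rw [h4, h0, h.multiplier_two (h.irrefl j)] at e2
  rw [h.multiplier_two (h.irrefl j)] at e1
  have : (2 : K) = 0 := by linear_combination e2 - e1
  exact two_ne_zero this

theorem eq_zero_of_two_le_degree (h : IsNormalized a l E) (h0 : ∀ j, l 3 j j = 0) (i j k : I)
    (q : I →₀ ℕ) : a i (Finsupp.single k 1 + Finsupp.single j 1 + q) = 0 := by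
  refine h.isMultiplier.add_eq_zero i _ q ?_
  by_cases hik : E i k
  swap
  · exact h.eq_zero_of_not_adj hik _
  by_cases hij : E i j
  swap
  · rw [add_comm]; exact h.eq_zero_of_not_adj hij _
  have e1 := h.multiplier_succ hik j (by omega : 1 ≤ 1)
  rw [h.multiplier_of_adj hij (by omega), h.multiplier_one,
    h.of_not_adj k j (h.not_triangle h0 hij hik), zero_add] at e1
  norm_num only at e1
  rw [h0] at e1
  exact (mul_eq_zero.1 e1.symm).resolve_left (Nat.cast_add_one_ne_zero _)

/-- The recursion has step two, so it starts from both `l 1 j j = 0` and `l 2 j j = 1`. -/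
theorem multiplier_diag (h : IsNormalized a l E) (h2 : ∀ j, l 3 j j = 2) (j : I) (n : ℕ) :
    l (n + 1) j j = n := by
  induction n using Nat.twoStepInduction with
  | zero => rw [h.multiplier_diag_one]; simp
  | one => rw [h.multiplier_two (h.irrefl j)]; simp
  | more n ih _ =>
    rw [h.multiplier_diag_add_two j (by omega : 1 ≤ n + 1), ih, h2]
    push_cast; ring

open Classical in
-- The right-hand multiplier is `l (p.degree + 2) j j = p.degree + 1`. Subtracting the exponents of
-- the neighbours of `j` leaves those of the class of `j`.
theorem recurrence (h : IsNormalized a l E) (h2 : ∀ j, l 3 j j = 2) {i j : I} (hij : E i j)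
    (p : I →₀ ℕ) : (p j + 1) * a i (p + Finsupp.single j 1) =
      (1 + ∑ k with ¬ E k j, (p k : K)) * a i p := by
  have e := h.isMultiplier 1 le_rfl i j p
  rw [h.multiplier_of_adj hij (by omega), h.multiplier_diag h2] at e
  have hs : ∑ k, (p k : K) * l 1 k j = ∑ k with E k j, (p k : K) := by
    rw [Finset.sum_filter]
    refine Finset.sum_congr rfl fun k _ => ?_
    rw [h.multiplier_one]
    split_ifs with hk
    · rw [h.of_adj k j hk, mul_one]
    · rw [h.of_not_adj k j hk, mul_zero]
  have hd : (p.degree : K) = ∑ k, (p k : K) := by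
    rw [Finsupp.degree_eq_sum]; push_cast; rfl
  rw [hs, one_mul, Nat.cast_add, hd, ← Finset.sum_filter_add_sum_filter_not Finset.univ (E · j)] at e
  push_cast at e
  linear_combination e

end IsNormalized

end Multipliers

/-! ### Normalization and identification of the two families. -/

section Classification

variable {K : Type v} [Field K] [CharZero K] {I : Type u} [Fintype I]

theorem pderiv_ne_zero_iff {a : I → (I →₀ ℕ) → K} {l : ℕ → I → I → K} (h : IsMultiplier a l)
    {F : I → MvPowerSeries I K} (ha : ∀ i p, a i p = MvPowerSeries.coeff p (F i)) (i j : I) :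
    MvPowerSeries.pderiv K j (F i) ≠ 0 ↔ MvPowerSeries.coeff (Finsupp.single j 1) (F i) ≠ 0 := by
  refine not_congr ⟨fun h0 => ?_, fun h0 => ?_⟩
  · have := MvPowerSeries.coeff_pderiv (i := j) (F i) 0
    simpa [h0] using this.symm
  · ext p
    rw [← ha] at h0
    rw [MvPowerSeries.coeff_pderiv, add_comm p, ← ha, h.add_eq_zero i _ p h0, zero_mul, map_zero]

theorem exists_isNormalized (F : I → MvPowerSeries I K)
    (hF : ∀ i, ∀ c : K, F i ≠ MvPowerSeries.C c)
    (hF1 : ∀ i, MvPowerSeries.constantCoeff (F i) = 1) (hconn : IsConnected F)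
    (hsymm : IsSymmetric F) (hHopf : IsHopf F) :
    ∃ (c : I → K) (l : ℕ → I → I → K) (E : I → I → Prop), (∀ j, c j ≠ 0) ∧
      IsNormalized (fun i p => MvPowerSeries.coeff p (MvPowerSeries.rescale c (F i))) l E := by
  obtain ⟨⟨l, hl⟩, lin⟩ := exists_isMultiplier F hF hF1 hHopf
  have hadj : ∀ i j, (graph F).Adj i j ↔ MvPowerSeries.coeff (Finsupp.single j 1) (F i) ≠ 0 :=
    pderiv_ne_zero_iff hl fun _ _ => rfl
  have hirr := hsymm.1
  have hsym : ∀ i j, (graph F).Adj i j → (graph F).Adj j i := fun i j hij => by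
    by_cases h : i = j
    · subst h; exact hij
    · exact (hsymm.2 i j h).1 hij
  -- The recurrence of `F_k` at 0 identifies this coefficient with `l 1 k j`; that of `F_j` at `e_k`
  -- in the direction `j`, where the leading term vanishes, gives `l 1 k j = l 2 j j`. So one scalar
  -- `(l 2 j j)⁻¹` normalizes the variable `h_j` in all equations at once.
  have hlin : ∀ k j, (graph F).Adj k j →
      MvPowerSeries.coeff (Finsupp.single j 1) (F k) = l 2 j j := by
    intro k j hkj
    have hjk := (hadj j k).1 (hsym _ _ hkj)
    have hjj : MvPowerSeries.coeff (Finsupp.single j 1) (F j) = 0 := by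
      by_contra h; exact hirr j ((hadj j j).2 h)
    have e0 := hl 1 le_rfl k j 0
    have e1 := hl 1 le_rfl j j (Finsupp.single k 1)
    beta_reduce at e1
    rw [add_comm _ (Finsupp.single j 1), hl.add_eq_zero j _ _ hjj,
      Finset.sum_eq_single k (fun b _ hb => by simp [hb.symm]) (by simp)] at e1
    simp only [Finsupp.single_eq_same, Finsupp.degree_single, mul_zero, zero_add, Nat.cast_one,
      one_mul] at e1
    rw [← mul_right_cancel₀ hjk e1]
    simpa [hF1] using e0
  have hne : ∀ j, l 2 j j ≠ 0 := fun j => by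
    obtain ⟨k, hk⟩ := lin j
    have hkj := hsym _ _ ((hadj j k).2 hk)
    rw [← hlin k j hkj]
    exact (hadj k j).1 hkj
  refine ⟨fun j => (l 2 j j)⁻¹, fun m i j => (l 2 j j)⁻¹ * l m i j, (graph F).Adj,
    fun j => inv_ne_zero (hne j), ?_, fun i => ?_, fun i j hij => ?_, fun i j hij => ?_, hsym, hirr,
    fun i => ?_, fun P i hi hP j => ?_⟩
  · simpa only [MvPowerSeries.coeff_rescale] using hl.rescale fun j => (l 2 j j)⁻¹
  · simp [MvPowerSeries.coeff_rescale, hF1]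
  · rw [MvPowerSeries.coeff_rescale, hlin i j hij]
    simp [hne j]
  · rw [MvPowerSeries.coeff_rescale, not_not.1 (mt (hadj i j).2 hij), mul_zero]
  · obtain ⟨j, hj⟩ := lin i
    exact ⟨j, (hadj i j).2 hj⟩
  · obtain ⟨w⟩ := hconn.preconnected i j
    induction w with
    | nil => exact hi
    | cons hadj' _ ih =>
      refine ih (hP _ _ hi ?_)
      rcases (SimpleGraph.fromRel_adj _ _ _).1 hadj' with ⟨_, h | h⟩
      · exact h
      · exact hsym _ _ h

omit [CharZero K] [Fintype I] in
theorem isChangeOfVariables_rescale (F : I → MvPowerSeries I K) {c : I → K} (hc : ∀ i, c i ≠ 0) :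
    IsChangeOfVariables F fun i => MvPowerSeries.rescale c (F i) :=
  ⟨c, 1, hc, fun _ => one_ne_zero, fun _ => (one_smul _ _).symm⟩

omit [CharZero K] in
theorem hasSubst_sum_X {J : Type*} [Finite J] (p : I → J) [DecidableEq J] :
    MvPowerSeries.HasSubst
      (fun j => ∑ y with p y = j, (MvPowerSeries.X y : MvPowerSeries I K)) :=
  MvPowerSeries.hasSubst_of_constantCoeff_zero fun j => by simp

theorem IsNormalized.isDilatation_cycleSystem {l : ℕ → I → I → K} {E : I → I → Prop} [Nonempty I]
    {F : I → MvPowerSeries I K}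
    (h : IsNormalized (fun i p => MvPowerSeries.coeff p (F i)) l E) (h0 : ∀ j, l 3 j j = 0) :
    IsDilatation (cycleSystem K 2) F := by
  classical
  obtain ⟨i₀⟩ := ‹Nonempty I›
  -- The neighbours of a base vertex form one class and all other vertices the second: triangles are
  -- excluded and nonadjacency is transitive.
  let p : I → ZMod 2 := fun x => if E i₀ x then 1 else 0
  have hp : ∀ x y, p y = p x + 1 ↔ E x y := by
    intro x y
    have h11 : (1 : ZMod 2) + 1 = 0 := by decide
    by_cases hx : E i₀ x <;> by_cases hy : E i₀ y <;> simp only [p, hx, hy, if_true, if_false]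
    · simp only [h11, one_ne_zero, false_iff]
      exact h.not_triangle h0 hy hx
    · simp only [h11, true_iff]
      exact h.adj_of_not_adj hy hx
    · simp only [zero_add, true_iff]
      exact h.symm _ _ (h.adj_of_not_adj hx hy)
    · simp only [zero_add, zero_ne_one, false_iff]
      intro hxy
      exact hy (h.symm _ _ (h.adj_of_not_adj (fun hx' => hx (h.symm _ _ hx')) hxy))
  refine ⟨p, fun b => ?_, fun x => ?_⟩
  · obtain ⟨k, hk⟩ := h.exists_adj i₀
    fin_cases b
    · exact ⟨i₀, if_neg (h.irrefl i₀)⟩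
    · exact ⟨k, if_pos hk⟩
  · have hs := hasSubst_sum_X (K := K) p
    have hsub : MvPowerSeries.subst (fun j => ∑ y with p y = j,
        (MvPowerSeries.X y : MvPowerSeries I K)) (cycleSystem K 2 (p x)) =
        1 + ∑ y with E x y, MvPowerSeries.X y := by
      rw [cycleSystem, MvPowerSeries.subst_add hs, MvPowerSeries.subst_X hs]
      simp only [hp]
      congr 1
      rw [← MvPowerSeries.coe_substAlgHom hs, map_one]
    have hgoal : F x = 1 + ∑ y with E x y, MvPowerSeries.X y := by
      ext q
      rw [map_add, map_sum, MvPowerSeries.coeff_one]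
      simp only [MvPowerSeries.coeff_X]
      by_cases hq0 : q = 0
      · subst hq0
        have hz : ∀ y : I, (0 : I →₀ ℕ) ≠ Finsupp.single y 1 := fun y hy => by
          simpa using DFunLike.congr_fun hy y
        simp [hz, h.zero x]
      obtain ⟨j, hj⟩ := Finsupp.ne_iff.1 hq0
      have hle : Finsupp.single j 1 ≤ q := by
        rw [Finsupp.single_le_iff]; exact Nat.one_le_iff_ne_zero.2 hj
      obtain ⟨r, rfl⟩ := exists_add_of_le hle
      rw [if_neg hq0, zero_add]
      by_cases hr : r = 0
      · subst hr
        rw [add_zero]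
        simp only [(Finsupp.single_left_injective (one_ne_zero : (1 : ℕ) ≠ 0)).eq_iff]
        rw [Finset.sum_ite_eq]
        simp only [Finset.mem_filter, Finset.mem_univ, true_and]
        split_ifs with hE
        · exact h.of_adj x j hE
        · exact h.of_not_adj x j hE
      · obtain ⟨k, hk⟩ := Finsupp.ne_iff.1 hr
        have hle' : Finsupp.single k 1 ≤ r := by
          rw [Finsupp.single_le_iff]; exact Nat.one_le_iff_ne_zero.2 hk
        obtain ⟨t, rfl⟩ := exists_add_of_le hle'
        rw [← add_assoc]
        refine (h.eq_zero_of_two_le_degree h0 x k j t).trans (Finset.sum_eq_zero fun y _ => ?_).symm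
        rw [if_neg]
        intro hy
        have := congrArg Finsupp.degree hy
        simp only [map_add, Finsupp.degree_single] at this
        omega
    rw [hgoal, ← hsub]
    congr!

omit [CharZero K] [Fintype I] in
theorem coeff_X_mul_pderiv (f : MvPowerSeries I K) (y : I) (q : I →₀ ℕ) :
    MvPowerSeries.coeff q (MvPowerSeries.X y * MvPowerSeries.pderiv K y f) =
      q y * MvPowerSeries.coeff q f := by
  classical
  rw [MvPowerSeries.X, MvPowerSeries.coeff_monomial_mul]
  split_ifs with hle
  · rw [MvPowerSeries.coeff_pderiv, tsub_add_cancel_of_le hle, one_mul]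
    simp only [Finsupp.coe_tsub, Pi.sub_apply, Finsupp.single_eq_same]
    rw [Nat.cast_sub (Finsupp.single_le_iff.1 hle)]
    push_cast
    ring
  · rw [Finsupp.single_le_iff, Nat.one_le_iff_ne_zero, not_not] at hle
    rw [hle]; simp

omit [CharZero K] in
theorem pderiv_prod_eq_zero {M : Type*} [DecidableEq M] (p : I → M) (T : Finset M) (j : I)
    (hj : p j ∉ T) : MvPowerSeries.pderiv K j
      (∏ b ∈ T, (1 - ∑ y with p y = b, (MvPowerSeries.X y : MvPowerSeries I K))) = 0 := by
  classical
  induction T using Finset.induction_on with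
  | empty => simp
  | insert b T hb ih =>
    rw [Finset.mem_insert, not_or] at hj
    rw [Finset.prod_insert hb, Derivation.leibniz, ih hj.2, smul_zero, zero_add, map_sub,
      Derivation.map_one_eq_zero, map_sum, Finset.sum_eq_zero, sub_zero, smul_zero]
    intro y hy
    refine MvPowerSeries.pderiv_X_of_ne fun hyj => hj.1 ?_
    rw [← hyj]
    exact (Finset.mem_filter.1 hy).2

/-- In characteristic zero a series is determined by its constant term and partial derivatives. With
`S` the sum of the variables in the class of `j`, the recurrence amounts to `(1 - S) ∂_j F_x = F_x`,
so the product has zero derivatives. -/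
theorem IsNormalized.mul_prod_eq_one {l : ℕ → I → I → K} {E : I → I → Prop}
    {F : I → MvPowerSeries I K} (h : IsNormalized (fun i p => MvPowerSeries.coeff p (F i)) l E)
    (h2 : ∀ j, l 3 j j = 2) {M : Type*} [DecidableEq M] [Fintype M] (p : I → M)
    (hp : ∀ x y, p x = p y ↔ ¬ E x y) (x : I) :
    F x * ∏ b ∈ Finset.univ.erase (p x),
      (1 - ∑ y with p y = b, (MvPowerSeries.X y : MvPowerSeries I K)) = 1 := by
  classical
  refine MvPowerSeries.pderiv.ext (fun j => ?_) ?_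
  · rw [MvPowerSeries.pderiv_one]
    by_cases hxj : E x j
    · have hmem : p j ∈ Finset.univ.erase (p x) :=
        Finset.mem_erase.2 ⟨fun hj => (hp x j).1 hj.symm hxj, Finset.mem_univ _⟩
      -- The sum of exponents in the recurrence becomes the Euler operator of the class of `j`.
      have e : ∀ k, p k = p j → MvPowerSeries.pderiv K k (F x) = F x + ∑ y with p y = p j,
          MvPowerSeries.X y * MvPowerSeries.pderiv K y (F x) := by
        intro k hk
        have hxk : E x k := by
          by_contra hxk
          exact (hp x j).1 (((hp x k).2 hxk).trans hk) hxj
        ext q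
        have hr := h.recurrence h2 hxk q
        simp only [← hp] at hr
        rw [MvPowerSeries.coeff_pderiv, mul_comm, hr, map_add, map_sum]
        simp only [coeff_X_mul_pderiv]
        rw [← Finset.sum_mul, add_mul, one_mul, hk]
      -- By `e`, the derivatives along all variables of a class coincide, so the Euler operator is
      -- `S` times any one of them.
      have hS : (∑ y with p y = p j, MvPowerSeries.X y) * MvPowerSeries.pderiv K j (F x) =
          ∑ y with p y = p j, MvPowerSeries.X y * MvPowerSeries.pderiv K y (F x) := by
        rw [Finset.sum_mul]
        refine Finset.sum_congr rfl fun y hy => ?_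
        rw [e j rfl, e y (Finset.mem_filter.1 hy).2]
      have hd : MvPowerSeries.pderiv K j
          (1 - ∑ y with p y = p j, (MvPowerSeries.X y : MvPowerSeries I K)) = -1 := by
        rw [map_sub, Derivation.map_one_eq_zero, map_sum, zero_sub,
          Finset.sum_eq_single_of_mem j (by simp), MvPowerSeries.pderiv_X_self]
        intro y _ hy
        exact MvPowerSeries.pderiv_X_of_ne hy
      rw [← Finset.mul_prod_erase _ _ hmem, Derivation.leibniz, Derivation.leibniz,
        pderiv_prod_eq_zero p _ j (by simp), hd, smul_zero, zero_add]
      simp only [smul_eq_mul]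
      have e0 := e j rfl
      rw [← hS] at e0
      linear_combination (∏ b ∈ (Finset.univ.erase (p x)).erase (p j),
        (1 - ∑ y with p y = b, (MvPowerSeries.X y : MvPowerSeries I K))) * e0
    · have hz : MvPowerSeries.pderiv K j (F x) = 0 := by
        ext q
        rw [MvPowerSeries.coeff_pderiv, add_comm q, map_zero]
        exact mul_eq_zero_of_left (h.eq_zero_of_not_adj hxj q) _
      rw [Derivation.leibniz, hz, smul_zero, add_zero, pderiv_prod_eq_zero p _ j (by
        rw [(hp x j).2 hxj]; exact Finset.notMem_erase _ _), smul_zero]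
  · have := h.zero x
    rw [MvPowerSeries.coeff_zero_eq_constantCoeff_apply] at this
    simp [this]

theorem IsNormalized.isDilatation_completeSystem {l : ℕ → I → I → K} {E : I → I → Prop}
    [Nonempty I] {F : I → MvPowerSeries I K}
    (h : IsNormalized (fun i p => MvPowerSeries.coeff p (F i)) l E) (h2 : ∀ j, l 3 j j = 2) :
    ∃ M, 2 ≤ M ∧ IsDilatation (completeSystem K M) F := by
  classical
  -- The parts of the dilatation are the classes of nonadjacency, and `M` is their number; an edge
  -- provides two distinct classes.
  let r : Setoid I := ⟨fun x y => ¬ E x y, fun x => h.irrefl x,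
    fun hxy hyx => hxy (h.symm _ _ hyx),
    fun {x y z} hxy hyz hxz => hyz (h.symm _ _ (h.adj_of_not_adj hxy hxz))⟩
  let e := Fintype.equivFin (Quotient r)
  have hp : ∀ x y, e (Quotient.mk r x) = e (Quotient.mk r y) ↔ ¬ E x y := fun x y => by
    rw [e.injective.eq_iff, Quotient.eq]; rfl
  refine ⟨Fintype.card (Quotient r), ?_, fun x => e (Quotient.mk r x), ?_, fun x => ?_⟩
  · obtain ⟨i⟩ := ‹Nonempty I›
    obtain ⟨k, hk⟩ := h.exists_adj i
    exact Fintype.one_lt_card_iff.2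
      ⟨Quotient.mk r i, Quotient.mk r k, fun hik => (hp i k).1 (congrArg e hik) hk⟩
  · exact e.surjective.comp Quotient.mk_surjective
  · have h1 := h.mul_prod_eq_one h2 (fun x => e (Quotient.mk r x)) hp x
    have hs := hasSubst_sum_X (K := K) fun x => e (Quotient.mk r x)
    have hX : ∀ j, MvPowerSeries.substAlgHom (R := K) hs (1 - MvPowerSeries.X j) =
        1 - ∑ y with e (Quotient.mk r y) = j, (MvPowerSeries.X y : MvPowerSeries I K) :=
      fun j => by rw [map_sub, map_one, MvPowerSeries.substAlgHom_X]
    have hc : completeSystem K (Fintype.card (Quotient r)) (e (Quotient.mk r x)) *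
        ∏ j ∈ Finset.univ.erase (e (Quotient.mk r x)), (1 - MvPowerSeries.X j) = 1 := by
      rw [completeSystem, ← Finset.prod_mul_distrib]
      exact Finset.prod_eq_one fun j _ => MvPowerSeries.inv_mul_cancel _ (by simp)
    have h3 := congrArg (MvPowerSeries.substAlgHom (R := K) hs) hc
    rw [map_mul, map_prod, map_one] at h3
    simp only [hX] at h3
    rw [MvPowerSeries.coe_substAlgHom] at h3
    -- `F x` and the dilated complete system are inverses of the same product.
    convert left_inv_eq_right_inv h1 ((mul_comm _ _).trans h3) using 1
    congr!

end Classification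

end DSE

theorem mainTheorem11 {K : Type v} [Field K] [CharZero K] {I : Type u} [Fintype I] [Nonempty I]
    (F : I → MvPowerSeries I K)
    (hF : ∀ i, ∀ c : K, F i ≠ MvPowerSeries.C c)
    (hF1 : ∀ i, MvPowerSeries.constantCoeff (F i) = 1)
    (hconn : DSE.IsConnected F)
    (hsymm : DSE.IsSymmetric F)
    (hHopf : DSE.IsHopf F) :
    DSE.IsMulticyclic 2 F ∨ DSE.IsQuasiComplete F := by
  obtain ⟨c, l, E, hc, h⟩ := DSE.exists_isNormalized F hF hF1 hconn hsymm hHopf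
  rcases h.multiplier_diag_three_dichotomy with h0 | h2
  · exact Or.inl ⟨le_rfl, _, DSE.isChangeOfVariables_rescale F hc, h.isDilatation_cycleSystem h0⟩
  · obtain ⟨M, hM, hd⟩ := h.isDilatation_completeSystem h2
    exact Or.inr ⟨M, hM, _, DSE.isChangeOfVariables_rescale F hc, hd⟩
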